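/- **Setting.** Fix $p$ and $\sigma\in\mathbb{R}$. For every $n$ let $\mathbb{X}=\mathbb{X}_n\in\mathbb{R}^{n\times p}$ be a deterministic matrix with rows $X_i^\top=X_{n,i}^\top$, let $\theta=\theta_n\in\mathbb{R}^p$, let $W=(W_{n,1},\dots,W_{n,n})$ be a vector of random variables, and let $Y=\mathbb{X}\theta+\sigma W$. (A fixed sequence $(X_i)$, a fixed $\theta$ and a fixed sequence $(W_i)$ are a special case.) For $\lambda\ge 0$ the lasso estimator is $$\widehat\theta(\lambda)=\arg\min_{b\in\mathbb{R}^p}\ \frac1{2n}\|Y-\mathbb{X}b\|_2^2+\lambda\|b\|_1 ,$$ and $\widehat\theta^{(i)}(\lambda)$ is the lasso estimator computed from the $n-1$ observations other than the $i$-th (with $n$ replaced by $n-1$ in the normalization). Under the assumptions below these minimizers are unique for all large $n$; for the remaining $n$ any minimizer is chosen. The predictive risk and its leave-one-out cross-validation estimator are $$R_n(\lambda)=\frac1n\,\mathbb{E}\|\mathbb{X}(\widehat\theta(\lambda)-\theta)\|_2^2+\sigma^2,\qquad \widehat R_n(\lambda)=\frac1n\sum_{i=1}^n\bigl(Y_i-X_i^\top\widehat\theta^{(i)}(\lambda)\bigr)^2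 .$$ **Assumptions.** (A) $\frac1n\mathbb{X}^\top\mathbb{X}\to C$ with $C$ positive definite. (B) $\|X_{n,i}\|_2\le C_X$ for all $n,i$. Moreover $\|\theta_n\|_1\le C_\theta$ for all $n$; for each $n$ the $W_{n,i}$ are independent; and there is $\tau<\infty$ with $\mathbb{E}e^{tW_{n,i}}\le e^{\tau^2t^2/2}$ for all $t\in\mathbb{R}$ and all $n,i$. Let $\Lambda\subset[0,\infty)$ be compact. **Theorem.** 1. Let $\widehat\lambda_n$ be random variables and $\lambda_n$ numbers such that, for all large $n$, almost surely $\widehat\lambda_n\in\Lambda$ minimizes $\widehat R_n$ over $\Lambda$, and $\lambda_n$ minimizes $R_n$ over $[0,\infty)$ and lies in $\Lambda$. Then $$R_n(\widehat\lambda_n)-R_n(\lambda_n)\to 0 .$$ This holds in both readings of $R_n(\widehat\lambda_n)$: in probability, if the function $R_n$ is evaluated at the random point $\widehat\lambda_n$; and as convergence of real numbers, if $R_n(\widehat\lambda_n)$ stands for $\frac1n\mathbb{E}\|\mathbb{X}(\widehat\theta(\widehat\lambda_n)-\theta)\|_2^2+\sigma^2$, where the expectation also integrates out the randomness of $\widehat\lambda_n$.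 This last expectation is finite for all large $n$. 2. For all large $n$, the expectation in $R_n(\lambda)$ is finite for every $\lambda\ge0$. 3. If moreover $\operatorname{Var}(W_{n,i})=1$ for all $n,i$, then $$\sup_{\lambda\in\Lambda}\bigl|\widehat R_n(\lambda)-R_n(\lambda)\bigr|\to 0\quad\text{in probability.}$$ -/

import Mathlib

open MeasureTheory ProbabilityTheory Filter Topology
open scoped Matrix NNReal ENNReal

noncomputable section

namespace LassoCV

/-- The lasso objective `b ↦ (1 / (2 n)) ‖y - X b‖₂² + lam ‖b‖₁`, where `n` is the number of
observations, i.e. of rows of `X`. -/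
def objective {ι : Type} [Fintype ι] {p : ℕ} (X : Matrix ι (Fin p) ℝ) (y : ι → ℝ) (lam : ℝ)
    (b : Fin p → ℝ) : ℝ :=
  1 / (2 * (Fintype.card ι : ℝ)) * ‖WithLp.toLp 2 (y - X *ᵥ b)‖ ^ 2 + lam * ∑ j, |b j|

/-- The lasso estimator: a minimizer of the lasso objective. For `0 ≤ lam` a minimizer exists, and
it is unique if `X` has full column rank. -/
def lasso {ι : Type} [Fintype ι] {p : ℕ} (X : Matrix ι (Fin p) ℝ) (y : ι → ℝ) (lam : ℝ) :
    Fin p → ℝ :=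
  Classical.epsilon fun b => IsMinOn (objective X y lam) Set.univ b

/-- The lasso estimator computed from all observations but the `i`-th one. -/
def lassoLOO {n p : ℕ} (X : Matrix (Fin n) (Fin p) ℝ) (y : Fin n → ℝ) (i : Fin n) (lam : ℝ) :
    Fin p → ℝ :=
  lasso (ι := {j : Fin n // j ≠ i}) (fun j => X j) (fun j => y j) lam

/-- The leave-one-out cross-validation estimator of the risk,
`(1 / n) ∑ᵢ (yᵢ - Xᵢᵀ b⁽ⁱ⁾(lam))²`. -/
def cvRisk {n p : ℕ} (X : Matrix (Fin n) (Fin p) ℝ) (y : Fin n → ℝ) (lam : ℝ) : ℝ :=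
  1 / (n : ℝ) * ∑ i, (y i - X i ⬝ᵥ lassoLOO X y i lam) ^ 2

/-- The linear model `Y = X θ + σ W`. -/
def response {n p : ℕ} (X : Matrix (Fin n) (Fin p) ℝ) (θ : Fin p → ℝ) (σ : ℝ)
    (w : Fin n → ℝ) : Fin n → ℝ :=
  X *ᵥ θ + σ • w

/-- The loss `(1 / n) ‖X (b - θ)‖₂²` of the lasso estimator `b` with tuning parameter `lam`, as
computed from the responses `y`. -/
def loss {n p : ℕ} (X : Matrix (Fin n) (Fin p) ℝ) (θ : Fin p → ℝ) (y : Fin n → ℝ)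
    (lam : ℝ) : ℝ :=
  1 / (n : ℝ) * ‖WithLp.toLp 2 (X *ᵥ (lasso X y lam - θ))‖ ^ 2

/-- The predictive risk `(1 / n) 𝔼 ‖X (b(lam) - θ)‖₂² + σ²` of the lasso at a deterministic
tuning parameter `lam`. -/
def risk {Ω : Type*} [MeasurableSpace Ω] (μ : Measure Ω) {n p : ℕ}
    (X : Matrix (Fin n) (Fin p) ℝ) (θ : Fin p → ℝ) (σ : ℝ) (W : Fin n → Ω → ℝ) (lam : ℝ) : ℝ :=
  (∫ ω, loss X θ (response X θ σ fun i => W i ω) lam ∂μ) + σ ^ 2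

/-- The predictive risk `(1 / n) 𝔼 ‖X (b(L) - θ)‖₂² + σ²` of the lasso at a tuning parameter `L`
that may depend on the data; the expectation integrates out the randomness of `L` as well. -/
def tunedRisk {Ω : Type*} [MeasurableSpace Ω] (μ : Measure Ω) {n p : ℕ}
    (X : Matrix (Fin n) (Fin p) ℝ) (θ : Fin p → ℝ) (σ : ℝ) (W : Fin n → Ω → ℝ)
    (L : Ω → ℝ) : ℝ :=
  (∫ ω, loss X θ (response X θ σ fun i => W i ω) (L ω) ∂μ) + σ ^ 2

end LassoCV

end

/-! Everything is compared with the lasso fitted to the noiseless responses `X *ᵥ θ`. Its loss is a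
deterministic function of the tuning parameter. Up to a constant times `errorBound`, the actual loss
equals this noiseless loss, and the cross-validated risk equals it plus `σ ^ 2` times the mean of
the squared noise. The bound `errorBound` does not involve the tuning parameter, so both comparisons
are uniform over `lam ≥ 0` without any covering argument, and its expectation is of order `1 / √n`.

The comparisons are deterministic (`abs_loss_sub_noiselessLoss_le`,
`abs_cvRisk_sub_noiselessLoss_le`). They rest on `sq_le_of_isMinOn_objective`: the variational
inequalities of two minimizers, added up, bound their distance by the difference of the gradients of
the quadratic parts at one common point, plus a multiple of the difference of the tuning parameters.
For a design with Gram matrix bounded below, the noise thus moves the lasso by at most a multiple of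
its score, and deleting one observation costs a further `O((1 + |wᵢ|) / n)`.

The mean of the squared noise is the same for all tuning parameters. It cancels when values of the
cross-validated risk are compared, so the first claim needs no assumption on the variance. Unit
variance makes this mean concentrate at `1`, which gives the uniform convergence. Markov's
inequality turns bounds in mean into convergence in probability. -/

namespace LassoCV

/-! ### Euclidean norm of plain vectors. -/

section EuclideanNorm

variable {ι : Type*} [Fintype ι]

/-- The Euclidean norm of a plain vector. -/
noncomputable abbrev l2 (v : ι → ℝ) : ℝ := ‖WithLp.toLp 2 v‖

theorem l2_sq (v : ι → ℝ) : l2 v ^ 2 = v ⬝ᵥ v := by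
  simp [l2, EuclideanSpace.real_norm_sq_eq, dotProduct, pow_two (v _)]

theorem l2_sq_eq_sum (v : ι → ℝ) : l2 v ^ 2 = ∑ i, v i ^ 2 := by
  simp [l2, EuclideanSpace.real_norm_sq_eq]

theorem l2_nonneg (v : ι → ℝ) : 0 ≤ l2 v := norm_nonneg _

theorem abs_dotProduct_le_l2_mul_l2 (u v : ι → ℝ) : |u ⬝ᵥ v| ≤ l2 u * l2 v := by
  have h := abs_real_inner_le_norm (WithLp.toLp 2 v : EuclideanSpace ℝ ι) (WithLp.toLp 2 u)
  rw [EuclideanSpace.inner_toLp_toLp] at h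
  simpa [mul_comm] using h

theorem abs_apply_le_l2 (v : ι → ℝ) (i : ι) : |v i| ≤ l2 v := by
  simpa using PiLp.norm_apply_le (WithLp.toLp 2 v : EuclideanSpace ℝ ι) i

theorem sum_abs_le_card_mul_l2 (v : ι → ℝ) : ∑ i, |v i| ≤ Fintype.card ι * l2 v := by
  refine (Finset.sum_le_sum fun i _ => abs_apply_le_l2 v i).trans ?_
  simp

theorem l2_le_sum_abs (v : ι → ℝ) : l2 v ≤ ∑ i, |v i| := by
  have h0 : 0 ≤ ∑ i, |v i| := Finset.sum_nonneg fun i _ => abs_nonneg _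
  refine abs_le_of_sq_le_sq' ?_ h0 |>.2
  rw [l2_sq_eq_sum]
  simpa using Finset.sum_sq_le_sq_sum_of_nonneg (s := Finset.univ) (f := fun i => |v i|)
    fun i _ => abs_nonneg _

end EuclideanNorm

/-! ### Variational inequality, existence and comparison of lasso minimizers. -/

section Minimizers

variable {ι κ : Type} [Fintype ι] [Fintype κ] {p : ℕ}

theorem nonneg_of_forall_add_mul_nonneg {a q : ℝ} (hq : 0 ≤ q)
    (h : ∀ t : ℝ, 0 < t → t ≤ 1 → 0 ≤ a + t * q) : 0 ≤ a := by
  by_contra! ha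
  -- The zero `-a / q` of `a + t * q` may exceed `1`, or fail to exist if `q = 0`; enlarging the
  -- denominator by `-a` puts `t` into `(0, 1]` and keeps the value negative.
  have h1 : 0 < -a / (q - a) := div_pos (by linarith) (by linarith)
  have h2 : -a / (q - a) ≤ 1 := by rw [div_le_one (by linarith)]; linarith
  have h3 := h _ h1 h2
  have h4 : a + -a / (q - a) * q = -a ^ 2 / (q - a) := by
    have : q - a ≠ 0 := by linarith
    field_simp
    ring
  rw [h4] at h3
  have : -a ^ 2 / (q - a) < 0 := div_neg_of_neg_of_pos (by nlinarith) (by linarith)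
  linarith

/-- The variational inequality satisfied by a minimizer of the lasso objective. -/
theorem gradient_le_of_isMinOn_objective {X : Matrix ι (Fin p) ℝ} {y : ι → ℝ} {lam : ℝ}
    (hlam : 0 ≤ lam) {b : Fin p → ℝ} (hb : IsMinOn (objective X y lam) Set.univ b)
    (b' : Fin p → ℝ) :
    1 / (Fintype.card ι : ℝ) * ((y - X *ᵥ b) ⬝ᵥ (X *ᵥ (b' - b))) ≤
      lam * (∑ j, |b' j| - ∑ j, |b j|) := by
  set N : ℝ := (Fintype.card ι : ℝ) with hN
  set d := b' - b with hd
  suffices 0 ≤ lam * (∑ j, |b' j| - ∑ j, |b j|) -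
      1 / N * ((y - X *ᵥ b) ⬝ᵥ (X *ᵥ d)) by linarith
  have hN0 : 0 ≤ 1 / (2 * N) := by positivity
  refine nonneg_of_forall_add_mul_nonneg (q := 1 / (2 * N) * (X *ᵥ d ⬝ᵥ X *ᵥ d)) ?_ ?_
  · rw [← l2_sq]; positivity
  intro t ht ht1
  have hmin : objective X y lam b ≤ objective X y lam (b + t • d) := hb (Set.mem_univ _)
  simp only [objective] at hmin
  rw [← hN] at hmin
  -- Convexity along the segment from `b` to `b'` replaces subgradients of the penalty.
  have hl1 : ∑ j, |(b + t • d) j| ≤ (1 - t) * ∑ j, |b j| + t * ∑ j, |b' j| := by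
    rw [Finset.mul_sum, Finset.mul_sum, ← Finset.sum_add_distrib]
    refine Finset.sum_le_sum fun j _ => ?_
    have : (b + t • d) j = (1 - t) * b j + t * b' j := by simp [hd]; ring
    rw [this]
    refine (abs_add_le _ _).trans ?_
    rw [abs_mul, abs_mul, abs_of_nonneg (by linarith : 0 ≤ 1 - t), abs_of_pos ht]
  have hsq : ‖WithLp.toLp 2 (y - X *ᵥ (b + t • d))‖ ^ 2 =
      ‖WithLp.toLp 2 (y - X *ᵥ b)‖ ^ 2 - 2 * t * ((y - X *ᵥ b) ⬝ᵥ (X *ᵥ d)) +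
        t ^ 2 * (X *ᵥ d ⬝ᵥ X *ᵥ d) := by
    have : y - X *ᵥ (b + t • d) = (y - X *ᵥ b) - t • (X *ᵥ d) := by
      rw [Matrix.mulVec_add, Matrix.mulVec_smul]; abel
    rw [this]
    change l2 _ ^ 2 = l2 _ ^ 2 - _ + _
    rw [l2_sq, l2_sq]
    generalize y - X *ᵥ b = r
    generalize X *ᵥ d = u
    simp only [sub_dotProduct, dotProduct_sub, smul_dotProduct, dotProduct_smul, smul_eq_mul,
      dotProduct_comm u r]
    ring
  rw [hsq] at hmin
  have hl1' := mul_le_mul_of_nonneg_left hl1 hlam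
  have e : 1 / N = 2 * (1 / (2 * N)) := by
    rw [one_div, one_div, mul_inv]; ring
  rw [e]
  set m := 1 / (2 * N)
  generalize (y - X *ᵥ b) ⬝ᵥ (X *ᵥ d) = A at *
  generalize X *ᵥ d ⬝ᵥ X *ᵥ d = B at *
  refine nonneg_of_mul_nonneg_right ?_ ht
  nlinarith

/-- Comparison of the minimizers of two lasso objectives. -/
theorem sq_le_of_isMinOn_objective {X₁ : Matrix ι (Fin p) ℝ} {y₁ : ι → ℝ} {X₂ : Matrix κ (Fin p) ℝ}
    {y₂ : κ → ℝ} {lam₁ lam₂ : ℝ} (hlam₁ : 0 ≤ lam₁) (hlam₂ : 0 ≤ lam₂) {b₁ b₂ : Fin p → ℝ}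
    (hb₁ : IsMinOn (objective X₁ y₁ lam₁) Set.univ b₁)
    (hb₂ : IsMinOn (objective X₂ y₂ lam₂) Set.univ b₂) :
    1 / (Fintype.card ι : ℝ) * l2 (X₁ *ᵥ (b₁ - b₂)) ^ 2 ≤
      1 / (Fintype.card ι : ℝ) * ((y₁ - X₁ *ᵥ b₂) ⬝ᵥ (X₁ *ᵥ (b₁ - b₂))) -
      1 / (Fintype.card κ : ℝ) * ((y₂ - X₂ *ᵥ b₂) ⬝ᵥ (X₂ *ᵥ (b₁ - b₂))) +
      |lam₁ - lam₂| * ∑ j, |(b₁ - b₂) j| := by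
  -- Each minimizer is tested against the other. In the sum the penalties leave only the factor
  -- `lam₁ - lam₂`, and moving the first residual from `b₁` to `b₂` produces the square.
  have h₁ := gradient_le_of_isMinOn_objective hlam₁ hb₁ b₂
  have h₂ := gradient_le_of_isMinOn_objective hlam₂ hb₂ b₁
  have hdiff : |(∑ j, |b₂ j| - ∑ j, |b₁ j|)| ≤ ∑ j, |(b₁ - b₂) j| := by
    rw [← Finset.sum_sub_distrib]
    refine (Finset.abs_sum_le_sum_abs _ _).trans (Finset.sum_le_sum fun j _ => ?_)
    refine (abs_abs_sub_abs_le _ _).trans ?_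
    rw [abs_sub_comm, Pi.sub_apply]
  have h₃ : (lam₁ - lam₂) * (∑ j, |b₂ j| - ∑ j, |b₁ j|) ≤
      |lam₁ - lam₂| * ∑ j, |(b₁ - b₂) j| := by
    refine (le_abs_self _).trans ?_
    rw [abs_mul]
    exact mul_le_mul_of_nonneg_left hdiff (abs_nonneg _)
  have e : (y₁ - X₁ *ᵥ b₁) ⬝ᵥ (X₁ *ᵥ (b₂ - b₁)) =
      l2 (X₁ *ᵥ (b₁ - b₂)) ^ 2 - (y₁ - X₁ *ᵥ b₂) ⬝ᵥ (X₁ *ᵥ (b₁ - b₂)) := by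
    rw [l2_sq]
    have e1 : X₁ *ᵥ (b₂ - b₁) = -(X₁ *ᵥ (b₁ - b₂)) := by
      rw [← Matrix.mulVec_neg, neg_sub]
    have e2 : y₁ - X₁ *ᵥ b₁ = (y₁ - X₁ *ᵥ b₂) - X₁ *ᵥ (b₁ - b₂) := by
      rw [Matrix.mulVec_sub]; abel
    rw [e1, e2, dotProduct_neg, sub_dotProduct]
    ring
  rw [e, mul_sub] at h₁
  linarith

theorem continuous_objective (X : Matrix ι (Fin p) ℝ) (y : ι → ℝ) (lam : ℝ) :
    Continuous (objective X y lam) := by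
  have : objective X y lam = fun b => 1 / (2 * (Fintype.card ι : ℝ)) *
      ((y - X *ᵥ b) ⬝ᵥ (y - X *ᵥ b)) + lam * ∑ j, |b j| := by
    funext b
    rw [← l2_sq]; rfl
  rw [this]
  fun_prop

/-- The lasso objective has a minimizer if the design has full column rank. -/
theorem isMinOn_lasso {X : Matrix ι (Fin p) ℝ} {c : ℝ} (hc : 0 < c) (hι : 0 < Fintype.card ι)
    (hX : ∀ v, c * l2 v ^ 2 ≤ l2 (X *ᵥ v) ^ 2) (y : ι → ℝ) {lam : ℝ} (hlam : 0 ≤ lam) :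
    IsMinOn (objective X y lam) Set.univ (lasso X y lam) := by
  refine Classical.epsilon_spec (p := fun b => IsMinOn (objective X y lam) Set.univ b) ?_
  suffices hlim : Tendsto (objective X y lam) (cocompact (Fin p → ℝ)) atTop by
    obtain ⟨b, hb⟩ := (continuous_objective X y lam).exists_forall_le hlim
    exact ⟨b, fun b' _ => hb b'⟩
  set m : ℝ := 1 / (2 * (Fintype.card ι : ℝ)) with hm
  have hm0 : 0 < m := by positivity
  -- Coercivity comes from the quadratic part alone, so `lam = 0` is included.
  have hlow : ∀ b, m * (c / 2) * ‖b‖ ^ 2 + (-(m * l2 y ^ 2)) ≤ objective X y lam b := by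
    intro b
    have h1 : ‖b‖ ≤ l2 b := by
      refine (pi_norm_le_iff_of_nonneg (l2_nonneg b)).2 fun j => abs_apply_le_l2 b j
    have h2 : ‖b‖ ^ 2 ≤ l2 b ^ 2 := pow_le_pow_left₀ (norm_nonneg _) h1 2
    have h3 : l2 (X *ᵥ b) ^ 2 ≤ 2 * l2 (y - X *ᵥ b) ^ 2 + 2 * l2 y ^ 2 := by
      simp only [l2_sq_eq_sum, Finset.mul_sum, ← Finset.sum_add_distrib]
      refine Finset.sum_le_sum fun i _ => ?_
      simp only [Pi.sub_apply]
      nlinarith [sq_nonneg (2 * y i - (X *ᵥ b) i)]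
    have h4 : c / 2 * ‖b‖ ^ 2 - l2 y ^ 2 ≤ l2 (y - X *ᵥ b) ^ 2 := by
      nlinarith [hX b]
    have h5 : 0 ≤ lam * ∑ j, |b j| := mul_nonneg hlam (Finset.sum_nonneg fun j _ => abs_nonneg _)
    have h6 := mul_le_mul_of_nonneg_left h4 hm0.le
    simp only [objective]
    linarith
  refine tendsto_atTop_mono hlow ?_
  refine tendsto_atTop_add_const_right _ _ ?_
  exact ((tendsto_pow_atTop two_ne_zero).comp (tendsto_norm_cocompact_atTop
    (E := Fin p → ℝ))).const_mul_atTop (by positivity)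

/-- The noiseless lasso is bounded by the regression vector in `ℓ¹`. -/
theorem l2_lasso_sub_le {X : Matrix ι (Fin p) ℝ} {c : ℝ} (hc : 0 < c) (hι : 0 < Fintype.card ι)
    (hX : ∀ v, c * l2 v ^ 2 ≤ l2 (X *ᵥ v) ^ 2) (θ : Fin p → ℝ) {lam : ℝ} (hlam : 0 ≤ lam) :
    l2 (lasso X (X *ᵥ θ) lam - θ) ≤ 2 * ∑ j, |θ j| := by
  have hmin := isMinOn_lasso hc hι hX (X *ᵥ θ) hlam
  set b := lasso X (X *ᵥ θ) lam
  have h : objective X (X *ᵥ θ) lam b ≤ objective X (X *ᵥ θ) lam θ := hmin (Set.mem_univ _)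
  have hθ0 : 0 ≤ ∑ j, |θ j| := Finset.sum_nonneg fun j _ => abs_nonneg _
  have hb0 : 0 ≤ ∑ j, |b j| := Finset.sum_nonneg fun j _ => abs_nonneg _
  simp only [objective, sub_self, WithLp.toLp_zero, norm_zero] at h
  have hm0 : 0 < 1 / (2 * (Fintype.card ι : ℝ)) := by positivity
  rw [← Matrix.mulVec_sub] at h
  -- Without a penalty the comparison with `θ` says nothing about the `ℓ¹` norm, but then full
  -- column rank forces `b = θ`.
  rcases hlam.eq_or_lt with rfl | hlam
  · have h1 : l2 (X *ᵥ (θ - b)) ^ 2 ≤ 0 := by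
      by_contra! h2
      have := mul_pos hm0 h2
      simp only [l2] at this
      linarith
    have h2 := hX (θ - b)
    have h3 : l2 (θ - b) = 0 := by
      have : l2 (θ - b) ^ 2 ≤ 0 := by
        by_contra! h4
        nlinarith [mul_pos hc h4]
      exact pow_eq_zero_iff two_ne_zero |>.1 (le_antisymm this (sq_nonneg _))
    have h4 : l2 (b - θ) = l2 (θ - b) := by
      simp only [l2, WithLp.toLp_sub]; exact norm_sub_rev _ _
    rw [h4, h3]; positivity
  · have h1 : ∑ j, |b j| ≤ ∑ j, |θ j| := by
      have h2 : 0 ≤ 1 / (2 * (Fintype.card ι : ℝ)) * ‖WithLp.toLp 2 (X *ᵥ (θ - b))‖ ^ 2 := by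
        positivity
      have : lam * ∑ j, |b j| ≤ lam * ∑ j, |θ j| := by linarith
      exact le_of_mul_le_mul_left this hlam
    calc l2 (b - θ) ≤ ∑ j, |(b - θ) j| := l2_le_sum_abs _
      _ ≤ ∑ j, (|b j| + |θ j|) := Finset.sum_le_sum fun j _ => abs_sub _ _
      _ ≤ 2 * ∑ j, |θ j| := by rw [Finset.sum_add_distrib]; linarith

end Minimizers

end LassoCV

/-! ### Stability of the lasso under noise and under deletion of an observation. -/

namespace LassoCV

variable {n p : ℕ}

/-- The score `(1 / n) Xᵀ u` of a noise vector `u`. -/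
noncomputable def score (X : Matrix (Fin n) (Fin p) ℝ) (u : Fin n → ℝ) : Fin p → ℝ :=
  (1 / (n : ℝ)) • (Xᵀ *ᵥ u)

theorem score_dotProduct (X : Matrix (Fin n) (Fin p) ℝ) (u : Fin n → ℝ) (d : Fin p → ℝ) :
    score X u ⬝ᵥ d = 1 / (n : ℝ) * (u ⬝ᵥ (X *ᵥ d)) := by
  rw [score, smul_dotProduct, Matrix.mulVec_transpose, Matrix.dotProduct_mulVec, smul_eq_mul]

theorem continuous_score (X : Matrix (Fin n) (Fin p) ℝ) : Continuous (score X) := by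
  unfold score
  fun_prop

theorem le_of_mul_sq_le_mul {c d s : ℝ} (hd : 0 ≤ d) (hs : 0 ≤ s)
    (h : c * d ^ 2 ≤ s * d) : c * d ≤ s := by
  rcases hd.eq_or_lt with rfl | hd
  · simpa using hs
  · exact le_of_mul_le_mul_right (by linarith [pow_two d, mul_assoc c d d]) hd

/-- A design with `n` rows of norm at most `C_X`, whose normalized Gram matrix is bounded below by
`c`, with `n` large enough for all of its leave-one-out designs to have full column rank. -/
structure GoodDesign (X : Matrix (Fin n) (Fin p) ℝ) (c C_X : ℝ) : Prop where
  two_le : 2 ≤ n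
  pos : 0 < c
  lower : ∀ v, n * c * l2 v ^ 2 ≤ l2 (X *ᵥ v) ^ 2
  nonneg : 0 ≤ C_X
  row_le : ∀ i, l2 (X i) ≤ C_X
  large : 2 * C_X ^ 2 ≤ n * c

namespace GoodDesign

variable {X : Matrix (Fin n) (Fin p) ℝ} {c C_X : ℝ}

theorem card_pos (h : GoodDesign X c C_X) : (0 : ℝ) < n := by
  have := h.two_le
  exact_mod_cast (by omega : 0 < n)

theorem isMinOn_lasso (h : GoodDesign X c C_X) (y : Fin n → ℝ) {lam : ℝ} (hlam : 0 ≤ lam) :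
    IsMinOn (objective X y lam) Set.univ (lasso X y lam) :=
  LassoCV.isMinOn_lasso (mul_pos h.card_pos h.pos) (by simpa using h.card_pos) h.lower y hlam

theorem abs_row_dotProduct_le (h : GoodDesign X c C_X) (i : Fin n) (v : Fin p → ℝ) :
    |X i ⬝ᵥ v| ≤ C_X * l2 v :=
  (abs_dotProduct_le_l2_mul_l2 _ _).trans
    (mul_le_mul_of_nonneg_right (h.row_le i) (l2_nonneg v))

theorem abs_dotProduct_mulVec_le (h : GoodDesign X c C_X) (u v : Fin p → ℝ) :
    1 / (n : ℝ) * |(X *ᵥ u) ⬝ᵥ (X *ᵥ v)| ≤ C_X ^ 2 * l2 u * l2 v := by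
  have h1 : |(X *ᵥ u) ⬝ᵥ (X *ᵥ v)| ≤ n * (C_X ^ 2 * l2 u * l2 v) := by
    refine (Finset.abs_sum_le_sum_abs _ _).trans ?_
    refine (Finset.sum_le_sum (g := fun _ => C_X ^ 2 * l2 u * l2 v) fun i _ => ?_).trans
      (by simp)
    rw [abs_mul]
    refine (mul_le_mul (h.abs_row_dotProduct_le i u) (h.abs_row_dotProduct_le i v) (abs_nonneg _)
      (mul_nonneg h.nonneg (l2_nonneg _))).trans (by apply le_of_eq; ring)
  rw [one_div, inv_mul_le_iff₀ h.card_pos]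
  exact h1

/-- The lasso is Lipschitz in the score of the responses and in the tuning parameter. -/
theorem l2_lasso_sub_lasso_le (h : GoodDesign X c C_X) (y₁ y₂ : Fin n → ℝ) {lam₁ lam₂ : ℝ}
    (hlam₁ : 0 ≤ lam₁) (hlam₂ : 0 ≤ lam₂) :
    c * l2 (lasso X y₁ lam₁ - lasso X y₂ lam₂) ≤
      l2 (score X (y₁ - y₂)) + |lam₁ - lam₂| * p := by
  have key := sq_le_of_isMinOn_objective hlam₁ hlam₂ (h.isMinOn_lasso y₁ hlam₁)
    (h.isMinOn_lasso y₂ hlam₂)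
  set b₂ := lasso X y₂ lam₂
  set d := lasso X y₁ lam₁ - b₂
  -- Both gradients are taken at `b₂`, so the fit cancels and only the responses differ.
  have e : 1 / (n : ℝ) * ((y₁ - X *ᵥ b₂) ⬝ᵥ (X *ᵥ d)) - 1 / (n : ℝ) * ((y₂ - X *ᵥ b₂) ⬝ᵥ (X *ᵥ d))
      = score X (y₁ - y₂) ⬝ᵥ d := by
    rw [score_dotProduct, ← mul_sub, ← sub_dotProduct]
    congr 2
    abel
  rw [Fintype.card_fin, e] at key
  have h1 := (le_abs_self _).trans (abs_dotProduct_le_l2_mul_l2 (score X (y₁ - y₂)) d)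
  have h2 := mul_le_mul_of_nonneg_left (sum_abs_le_card_mul_l2 d) (abs_nonneg (lam₁ - lam₂))
  rw [Fintype.card_fin] at h2
  have h3 : c * l2 d ^ 2 ≤ 1 / (n : ℝ) * l2 (X *ᵥ d) ^ 2 := by
    have := h.lower d
    rw [one_div, le_inv_mul_iff₀ h.card_pos]
    linarith
  refine le_of_mul_sq_le_mul (l2_nonneg d) ?_ ?_
  · have := l2_nonneg (score X (y₁ - y₂))
    positivity
  · linarith

theorem l2_lasso_noiseless_sub_le (h : GoodDesign X c C_X) {θ : Fin p → ℝ} {C_θ : ℝ}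
    (hθ : ∑ j, |θ j| ≤ C_θ) {lam : ℝ} (hlam : 0 ≤ lam) :
    l2 (lasso X (X *ᵥ θ) lam - θ) ≤ 2 * C_θ :=
  (l2_lasso_sub_le (mul_pos h.card_pos h.pos) (by simpa using h.card_pos) h.lower θ hlam).trans
    (by linarith)

theorem sum_subtype_ne (i : Fin n) (f : Fin n → ℝ) :
    ∑ j : {j : Fin n // j ≠ i}, f j = ∑ j, f j - f i := by
  rw [← Finset.sum_subtype (Finset.univ.erase i) (by simp) f,
    Finset.sum_erase_eq_sub (Finset.mem_univ i)]

/-- A leave-one-out lasso is close to the noiseless lasso. -/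
theorem l2_lassoLOO_sub_le (h : GoodDesign X c C_X) {θ : Fin p → ℝ} {C_θ : ℝ}
    (hθ : ∑ j, |θ j| ≤ C_θ) (σ : ℝ) (w : Fin n → ℝ) (i : Fin n) {lam : ℝ} (hlam : 0 ≤ lam) :
    c / 2 * l2 (lassoLOO X (response X θ σ w) i lam - lasso X (X *ᵥ θ) lam) ≤
      l2 (score X (σ • w)) + (|σ| * |w i| * C_X + 4 * C_X ^ 2 * C_θ) / n := by
  have hn := h.card_pos
  have hn1 : (0 : ℝ) < n - 1 := by
    have : (2 : ℝ) ≤ n := by exact_mod_cast h.two_le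
    linarith
  have hcard : (Fintype.card {j : Fin n // j ≠ i} : ℝ) = n - 1 := by
    rw [Fintype.card_subtype_compl, Fintype.card_fin, Fintype.card_unique, Nat.cast_sub]
    · simp
    · have := h.two_le; omega
  set X' : Matrix {j : Fin n // j ≠ i} (Fin p) ℝ := fun j => X j with hX'
  set y' : {j : Fin n // j ≠ i} → ℝ := fun j => response X θ σ w j with hy'
  have hsq : ∀ v, l2 (X' *ᵥ v) ^ 2 = l2 (X *ᵥ v) ^ 2 - (X i ⬝ᵥ v) ^ 2 := by
    intro v
    rw [l2_sq_eq_sum, l2_sq_eq_sum]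
    exact sum_subtype_ne i fun j => (X j ⬝ᵥ v) ^ 2
  -- Deleting a row loses at most `C_X ^ 2 * l2 v ^ 2`, which by `large` is at most half of the
  -- lower bound.
  have hlow : ∀ v, n * (c / 2) * l2 v ^ 2 ≤ l2 (X' *ᵥ v) ^ 2 := by
    intro v
    rw [hsq]
    have h1 := h.lower v
    have h2 : (X i ⬝ᵥ v) ^ 2 ≤ C_X ^ 2 * l2 v ^ 2 := by
      rw [← mul_pow, ← sq_abs]
      exact pow_le_pow_left₀ (abs_nonneg _) (h.abs_row_dotProduct_le i v) 2
    nlinarith [h.large, sq_nonneg (l2 v)]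
  have hmin : IsMinOn (objective X' y' lam) Set.univ (lassoLOO X (response X θ σ w) i lam) := by
    refine LassoCV.isMinOn_lasso (mul_pos hn (half_pos h.pos)) ?_ hlow y' hlam
    have : (0 : ℝ) < Fintype.card {j : Fin n // j ≠ i} := by rw [hcard]; exact hn1
    exact_mod_cast this
  have key := sq_le_of_isMinOn_objective hlam hlam hmin (h.isMinOn_lasso (X *ᵥ θ) hlam)
  have hbθ := h.l2_lasso_noiseless_sub_le hθ hlam
  set b₀ := lasso X (X *ᵥ θ) lam
  set d := lassoLOO X (response X θ σ w) i lam - b₀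
  set e := b₀ - θ with he
  have hdot : (y' - X' *ᵥ b₀) ⬝ᵥ (X' *ᵥ d) =
      (σ • w - X *ᵥ e) ⬝ᵥ (X *ᵥ d) - (σ * w i - X i ⬝ᵥ e) * (X i ⬝ᵥ d) := by
    have : ∀ j, response X θ σ w j - X j ⬝ᵥ b₀ = σ * w j - X j ⬝ᵥ e := by
      intro j
      simp only [response, he, Pi.add_apply, Pi.smul_apply, smul_eq_mul, dotProduct_sub,
        Matrix.mulVec]
      ring
    have h1 := sum_subtype_ne i fun j => (σ * w j - X j ⬝ᵥ e) * (X j ⬝ᵥ d)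
    refine Eq.trans ?_ h1
    refine Finset.sum_congr rfl fun j _ => ?_
    rw [← this]
    rfl
  have hdot0 : X *ᵥ θ - X *ᵥ b₀ = -(X *ᵥ e) := by
    rw [he, Matrix.mulVec_sub]; abel
  rw [hcard, Fintype.card_fin, hdot, hdot0, sub_self, abs_zero, zero_mul, add_zero,
    sub_dotProduct, neg_dotProduct] at key
  have hscore : (σ • w) ⬝ᵥ (X *ᵥ d) = n * (score X (σ • w) ⬝ᵥ d) := by
    rw [score_dotProduct]; field_simp
  have h1 := (le_abs_self _).trans (abs_dotProduct_le_l2_mul_l2 (score X (σ • w)) d)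
  have h2 := hlow d
  have h3 := h.abs_dotProduct_mulVec_le e d
  have hC : 0 ≤ C_θ := by linarith [l2_nonneg e]
  have hd := l2_nonneg d
  have h3' : 1 / (n : ℝ) * |(X *ᵥ e) ⬝ᵥ (X *ᵥ d)| ≤ 2 * C_X ^ 2 * C_θ * l2 d := by
    refine h3.trans ?_
    have := mul_le_mul_of_nonneg_right (mul_le_mul_of_nonneg_left hbθ (sq_nonneg C_X)) hd
    linarith
  have h4 : |(σ * w i - X i ⬝ᵥ e) * (X i ⬝ᵥ d)| ≤
      (|σ| * |w i| * C_X + 2 * C_X ^ 2 * C_θ) * l2 d := by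
    rw [abs_mul]
    have a1 := h.abs_row_dotProduct_le i d
    have a2 : |σ * w i - X i ⬝ᵥ e| ≤ |σ| * |w i| + C_X * (2 * C_θ) := by
      refine (abs_sub _ _).trans ?_
      rw [abs_mul]
      have := (h.abs_row_dotProduct_le i e).trans (mul_le_mul_of_nonneg_left hbθ h.nonneg)
      linarith
    refine (mul_le_mul a2 a1 (abs_nonneg _) ?_).trans (by apply le_of_eq; ring)
    have := h.nonneg
    positivity
  -- After multiplication by `n - 1` the normalizations `1 / (n - 1)` and `1 / n` nearly cancel: the
  -- noiseless residual keeps only the coefficient `1 / n`. This mismatch and the deleted row each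
  -- contribute `2 * C_X ^ 2 * C_θ`.
  have key' : n * (c / 2) * l2 d ^ 2 ≤ n * (score X (σ • w) ⬝ᵥ d) +
      1 / (n : ℝ) * |(X *ᵥ e) ⬝ᵥ (X *ᵥ d)| + |(σ * w i - X i ⬝ᵥ e) * (X i ⬝ᵥ d)| := by
    rw [hscore] at key
    have k1 := mul_le_mul_of_nonneg_left key hn1.le
    have k2 : ((n : ℝ) - 1) * (1 / ((n : ℝ) - 1)) = 1 := by field_simp
    have k3 : ((n : ℝ) - 1) * (1 / (n : ℝ)) = 1 - 1 / n := by field_simp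
    rw [mul_sub ((n : ℝ) - 1), ← mul_assoc, ← mul_assoc, ← mul_assoc, k2, k3] at k1
    have a1 := neg_abs_le ((X *ᵥ e) ⬝ᵥ (X *ᵥ d))
    have a2 := neg_abs_le ((σ * w i - X i ⬝ᵥ e) * (X i ⬝ᵥ d))
    have a3 : 0 < 1 / (n : ℝ) := by positivity
    have a4 := mul_le_mul_of_nonneg_left a1 a3.le
    linarith
  refine le_of_mul_sq_le_mul hd ?_ ?_
  · have := h.nonneg
    have := l2_nonneg (score X (σ • w))
    positivity
  · have e1 : (l2 (score X (σ • w)) + (|σ| * |w i| * C_X + 4 * C_X ^ 2 * C_θ) / n) * l2 d =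
        (n * (l2 (score X (σ • w)) * l2 d) +
          (|σ| * |w i| * C_X + 4 * C_X ^ 2 * C_θ) * l2 d) / n := by field_simp
    rw [e1, le_div_iff₀ hn]
    have := mul_le_mul_of_nonneg_left h1 hn.le
    linarith

end GoodDesign

end LassoCV

/-! ### Deterministic bounds for the loss and the cross-validated risk. -/

namespace LassoCV

variable {n p : ℕ}

/-- The bound on the estimation errors: `√n ‖(1 / n) Xᵀ u‖² + (1 + (1 / n) ∑ᵢ wᵢ²) / √n` with
`u = σ w`. -/
noncomputable def errorBound (X : Matrix (Fin n) (Fin p) ℝ) (σ : ℝ) (w : Fin n → ℝ) : ℝ :=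
  √n * l2 (score X (σ • w)) ^ 2 + (1 + 1 / (n : ℝ) * ∑ i, w i ^ 2) / √n

theorem errorBound_eq_mean (hn : (0 : ℝ) < n) (X : Matrix (Fin n) (Fin p) ℝ) (σ : ℝ)
    (w : Fin n → ℝ) : errorBound X σ w =
      1 / (n : ℝ) * ∑ i, (√n * l2 (score X (σ • w)) ^ 2 + (1 + w i ^ 2) / √n) := by
  rw [errorBound, Finset.sum_add_distrib, ← Finset.sum_div, Finset.sum_add_distrib]
  simp only [Finset.sum_const, Finset.card_univ, Fintype.card_fin, nsmul_eq_mul, mul_one]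
  have := Real.sqrt_pos.2 hn
  field_simp

theorem l2_score_le_errorBound (hn : (0 : ℝ) < n) (X : Matrix (Fin n) (Fin p) ℝ) (σ : ℝ)
    (w : Fin n → ℝ) : l2 (score X (σ • w)) ≤ errorBound X σ w := by
  have hs := Real.sqrt_pos.2 hn
  set γ := l2 (score X (σ • w))
  have h1 : 0 ≤ 1 / (n : ℝ) * ∑ i, w i ^ 2 :=
    mul_nonneg (by positivity) (Finset.sum_nonneg fun i _ => sq_nonneg _)
  have h2 : 1 / √n ≤ (1 + 1 / (n : ℝ) * ∑ i, w i ^ 2) / √n :=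
    div_le_div_of_nonneg_right (by linarith) hs.le
  have h3 : γ ≤ √n * γ ^ 2 + 1 / √n := by
    have : √n * γ ^ 2 + 1 / √n - γ = ((√n * γ - 1 / 2) ^ 2 + 3 / 4) / √n := by
      field_simp
      ring
    have : 0 ≤ ((√n * γ - 1 / 2) ^ 2 + 3 / 4) / √n := by positivity
    linarith
  rw [errorBound]
  linarith

theorem errorBound_nonneg (X : Matrix (Fin n) (Fin p) ℝ) (σ : ℝ) (w : Fin n → ℝ) :
    0 ≤ errorBound X σ w := by
  have : 0 ≤ ∑ i, w i ^ 2 := Finset.sum_nonneg fun i _ => sq_nonneg _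
  unfold errorBound
  positivity

/-- This is the change of a squared residual `r ^ 2` when `r` is shifted by `-a`. The product `γ *
(1 + |w|)` is split by the arithmetic-geometric mean inequality with weight `√N`: when `γ ^ 2` has
mean of order `1 / N`, both resulting terms are of order `1 / √N`. -/
theorem abs_sq_sub_two_mul_le {N L H γ w a r : ℝ} (hN : 1 ≤ N) (hL : 0 ≤ L) (hH : 0 ≤ H)
    (hγ : 0 ≤ γ) (ha : |a| ≤ L * (γ + (1 + |w|) / N)) (hr : |r| ≤ H * (1 + |w|)) :
    |a ^ 2 - 2 * a * r| ≤ (4 * L ^ 2 + 6 * L * H) * (√N * γ ^ 2 + (1 + w ^ 2) / √N) := by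
  set s := √N with hs_def
  have hs : 1 ≤ s := Real.one_le_sqrt.2 hN
  have hsN : s ^ 2 = N := Real.sq_sqrt (by linarith)
  rw [← hsN] at ha
  have hs0 : 0 < s := by linarith
  set h := 1 + |w| with hh
  have hh0 : 0 ≤ h := by positivity
  have hh2 : h ^ 2 ≤ 2 * (1 + w ^ 2) := by
    rw [hh, ← sq_abs w]
    nlinarith [sq_nonneg (1 - |w|)]
  set T := s * γ ^ 2 + h ^ 2 / s with hT
  have hT0 : 0 ≤ T := by positivity
  have b1 : γ * h ≤ T / 2 := by
    have : T / 2 - γ * h = (s * γ - h) ^ 2 / (2 * s) := by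
      rw [hT]; field_simp; ring
    have : 0 ≤ (s * γ - h) ^ 2 / (2 * s) := by positivity
    linarith
  have b2 : h ^ 2 / s ^ 2 ≤ h ^ 2 / s :=
    div_le_div_of_nonneg_left (by positivity) hs0 (by nlinarith)
  have b3 : h ^ 2 / s ≤ T := by
    have : 0 ≤ s * γ ^ 2 := by positivity
    linarith
  have b4 : γ ^ 2 ≤ s * γ ^ 2 := by nlinarith [sq_nonneg γ]
  have b5 : (h / s ^ 2) ^ 2 ≤ h ^ 2 / s := by
    rw [div_pow]
    refine div_le_div_of_nonneg_left (by positivity) hs0 ?_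
    calc s ≤ s ^ 2 := by nlinarith
      _ ≤ (s ^ 2) ^ 2 := by nlinarith [sq_nonneg s, sq_nonneg (s ^ 2), one_le_pow₀ hs (n := 2)]
  have c1 : (γ + h / s ^ 2) ^ 2 ≤ 2 * T := by
    nlinarith [sq_nonneg (γ - h / s ^ 2)]
  have c2 : (γ + h / s ^ 2) * h ≤ 3 / 2 * T := by
    have : (γ + h / s ^ 2) * h = γ * h + h ^ 2 / s ^ 2 := by ring
    linarith
  have hu : 0 ≤ γ + h / s ^ 2 := by positivity
  have d1 : |a| ^ 2 ≤ L ^ 2 * (2 * T) := by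
    calc |a| ^ 2 ≤ (L * (γ + h / s ^ 2)) ^ 2 := pow_le_pow_left₀ (abs_nonneg _) ha 2
      _ = L ^ 2 * (γ + h / s ^ 2) ^ 2 := by ring
      _ ≤ _ := mul_le_mul_of_nonneg_left c1 (sq_nonneg _)
  have d2 : |a| * |r| ≤ L * H * (3 / 2 * T) := by
    calc |a| * |r| ≤ (L * (γ + h / s ^ 2)) * (H * h) :=
          mul_le_mul ha hr (abs_nonneg _) (by positivity)
      _ = L * H * ((γ + h / s ^ 2) * h) := by ring
      _ ≤ _ := mul_le_mul_of_nonneg_left c2 (by positivity)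
  have d3 : T ≤ 2 * (s * γ ^ 2 + (1 + w ^ 2) / s) := by
    have : h ^ 2 / s ≤ 2 * (1 + w ^ 2) / s := div_le_div_of_nonneg_right hh2 hs0.le
    have e : 2 * (1 + w ^ 2) / s = 2 * ((1 + w ^ 2) / s) := by ring
    have : 0 ≤ s * γ ^ 2 := by positivity
    rw [hT]
    linarith
  calc |a ^ 2 - 2 * a * r| ≤ |a| ^ 2 + 2 * (|a| * |r|) := by
        refine (abs_sub _ _).trans (le_of_eq ?_)
        rw [abs_pow, abs_mul, abs_mul, abs_two]; ring
    _ ≤ (2 * L ^ 2 + 3 * L * H) * T := by linarith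
    _ ≤ (2 * L ^ 2 + 3 * L * H) * (2 * (s * γ ^ 2 + (1 + w ^ 2) / s)) :=
        mul_le_mul_of_nonneg_left d3 (by positivity)
    _ = _ := by ring

/-- The loss of the lasso in the noiseless model. -/
noncomputable def noiselessLoss (X : Matrix (Fin n) (Fin p) ℝ) (θ : Fin p → ℝ) (lam : ℝ) : ℝ :=
  loss X θ (X *ᵥ θ) lam

theorem mean_mul_le_of_le {f g : Fin n → ℝ} {K : ℝ} (h : ∀ i, |f i| ≤ K * g i) :
    |1 / (n : ℝ) * ∑ i, f i| ≤ K * (1 / (n : ℝ) * ∑ i, g i) := by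
  have hn : 0 ≤ 1 / (n : ℝ) := by positivity
  rw [abs_mul, abs_of_nonneg hn, mul_left_comm]
  refine mul_le_mul_of_nonneg_left ?_ hn
  refine (Finset.abs_sum_le_sum_abs _ _).trans ?_
  rw [Finset.mul_sum]
  exact Finset.sum_le_sum fun i _ => h i

theorem noiselessLoss_eq (X : Matrix (Fin n) (Fin p) ℝ) (θ : Fin p → ℝ) (lam : ℝ) :
    noiselessLoss X θ lam = 1 / (n : ℝ) * ∑ i, (X i ⬝ᵥ (lasso X (X *ᵥ θ) lam - θ)) ^ 2 := by
  rw [noiselessLoss, loss]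
  congr 1
  exact l2_sq_eq_sum _

theorem loss_eq (X : Matrix (Fin n) (Fin p) ℝ) (θ : Fin p → ℝ) (y : Fin n → ℝ) (lam : ℝ) :
    loss X θ y lam = 1 / (n : ℝ) * ∑ i, (X i ⬝ᵥ (lasso X y lam - θ)) ^ 2 := by
  rw [loss]
  congr 1
  exact l2_sq_eq_sum _

/-- The size of the shift of a fitted value, relative to `‖(1 / n) Xᵀ u‖ + (1 + |wᵢ|) / n`. -/
noncomputable def shiftConst (c C_X C_θ σ : ℝ) : ℝ :=
  C_X * (2 / c * (1 + |σ| * C_X + 4 * C_X ^ 2 * C_θ))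

/-- The size of the residuals of the noiseless lasso, relative to `1 + |wᵢ|`. -/
noncomputable def residualConst (C_X C_θ σ : ℝ) : ℝ := |σ| + 2 * C_X * C_θ

/-- The factor of `errorBound` in the bounds on the loss and on the cross-validated risk. -/
noncomputable def errorConst (c C_X C_θ σ : ℝ) : ℝ :=
  4 * shiftConst c C_X C_θ σ ^ 2 + 6 * shiftConst c C_X C_θ σ * residualConst C_X C_θ σ +
    4 * C_θ

namespace GoodDesign

variable {X : Matrix (Fin n) (Fin p) ℝ} {c C_X C_θ : ℝ} {θ : Fin p → ℝ}

theorem shiftConst_nonneg (h : GoodDesign X c C_X) (hC : 0 ≤ C_θ) (σ : ℝ) :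
    0 ≤ shiftConst c C_X C_θ σ := by
  have := h.nonneg
  have := h.pos
  unfold shiftConst
  positivity

theorem residualConst_nonneg (h : GoodDesign X c C_X) (hC : 0 ≤ C_θ) (σ : ℝ) :
    0 ≤ residualConst C_X C_θ σ := by
  have := h.nonneg
  unfold residualConst
  positivity

theorem errorConst_nonneg (h : GoodDesign X c C_X) (hC : 0 ≤ C_θ) (σ : ℝ) :
    0 ≤ errorConst c C_X C_θ σ := by
  have := h.shiftConst_nonneg hC σ
  have := h.residualConst_nonneg hC σ
  unfold errorConst
  positivity

theorem abs_residual_le (h : GoodDesign X c C_X) (hθ : ∑ j, |θ j| ≤ C_θ) (σ w : ℝ) (i : Fin n)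
    {lam : ℝ} (hlam : 0 ≤ lam) :
    |σ * w| + |X i ⬝ᵥ (lasso X (X *ᵥ θ) lam - θ)| ≤ residualConst C_X C_θ σ * (1 + |w|) := by
  have h1 := (h.abs_row_dotProduct_le i (lasso X (X *ᵥ θ) lam - θ)).trans
    (mul_le_mul_of_nonneg_left (h.l2_lasso_noiseless_sub_le hθ hlam) h.nonneg)
  have hC : 0 ≤ C_θ := (Finset.sum_nonneg fun j _ => abs_nonneg _).trans hθ
  have h2 : 0 ≤ C_X * C_θ * |w| := mul_nonneg (mul_nonneg h.nonneg hC) (abs_nonneg _)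
  rw [abs_mul, residualConst]
  linarith [abs_nonneg σ]

/-- The assumption on `d` has the form of the leave-one-out estimate. The full-sample shift
satisfies it a fortiori, so one constant serves both. -/
theorem abs_row_shift_le (h : GoodDesign X c C_X) (hC : 0 ≤ C_θ) {σ w γ : ℝ} (hγ : 0 ≤ γ)
    {d : Fin p → ℝ} (hd : c / 2 * l2 d ≤ γ + (|σ| * |w| * C_X + 4 * C_X ^ 2 * C_θ) / n)
    (i : Fin n) :
    |X i ⬝ᵥ d| ≤ shiftConst c C_X C_θ σ * (γ + (1 + |w|) / n) := by
  have hc := h.pos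
  have hX := h.nonneg
  have hn := h.card_pos
  have h1 : γ + (|σ| * |w| * C_X + 4 * C_X ^ 2 * C_θ) / n ≤
      (1 + |σ| * C_X + 4 * C_X ^ 2 * C_θ) * (γ + (1 + |w|) / n) := by
    have e1 : (|σ| * |w| * C_X + 4 * C_X ^ 2 * C_θ) / n ≤
        (1 + |σ| * C_X + 4 * C_X ^ 2 * C_θ) * ((1 + |w|) / n) := by
      rw [← mul_div_assoc]
      refine div_le_div_of_nonneg_right ?_ hn.le
      have p1 : 0 ≤ |σ| * C_X := by positivity
      have p2 : 0 ≤ 4 * C_X ^ 2 * C_θ * |w| := by positivity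
      have p3 := abs_nonneg w
      nlinarith
    have e2 : γ ≤ (1 + |σ| * C_X + 4 * C_X ^ 2 * C_θ) * γ := by
      have p1 : 0 ≤ (|σ| * C_X + 4 * C_X ^ 2 * C_θ) * γ := by positivity
      linarith
    linarith
  have h2 : l2 d ≤ 2 / c * ((1 + |σ| * C_X + 4 * C_X ^ 2 * C_θ) * (γ + (1 + |w|) / n)) := by
    have := mul_le_mul_of_nonneg_left (hd.trans h1) (by positivity : 0 ≤ 2 / c)
    have e : 2 / c * (c / 2 * l2 d) = l2 d := by field_simp
    rwa [e] at this
  calc |X i ⬝ᵥ d| ≤ C_X * l2 d := h.abs_row_dotProduct_le i d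
    _ ≤ C_X * (2 / c * ((1 + |σ| * C_X + 4 * C_X ^ 2 * C_θ) * (γ + (1 + |w|) / n))) :=
        mul_le_mul_of_nonneg_left h2 hX
    _ = _ := by rw [shiftConst]; ring

theorem abs_loss_sub_noiselessLoss_le (h : GoodDesign X c C_X) (hθ : ∑ j, |θ j| ≤ C_θ) (σ : ℝ)
    (w : Fin n → ℝ) {lam : ℝ} (hlam : 0 ≤ lam) :
    |loss X θ (response X θ σ w) lam - noiselessLoss X θ lam| ≤
      errorConst c C_X C_θ σ * errorBound X σ w := by
  have hn := h.card_pos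
  have hC : 0 ≤ C_θ := (Finset.sum_nonneg fun j _ => abs_nonneg _).trans hθ
  have hN : (1 : ℝ) ≤ n := by exact_mod_cast (by have := h.two_le; omega : 1 ≤ n)
  have hlip := h.l2_lasso_sub_lasso_le (response X θ σ w) (X *ᵥ θ) hlam hlam
  have hres : response X θ σ w - X *ᵥ θ = σ • w := by simp [response]
  rw [hres, sub_self, abs_zero, zero_mul, add_zero] at hlip
  have hγ := l2_nonneg (score X (σ • w))
  rw [loss_eq, noiselessLoss_eq, ← mul_sub, ← Finset.sum_sub_distrib]
  refine le_trans (mean_mul_le_of_le (K := 4 * shiftConst c C_X C_θ σ ^ 2 +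
    6 * shiftConst c C_X C_θ σ * residualConst C_X C_θ σ)
    (g := fun i => √n * l2 (score X (σ • w)) ^ 2 + (1 + w i ^ 2) / √n) fun i => ?_) ?_
  · have hr := h.abs_residual_le hθ σ (w i) i hlam
    set b₀ := lasso X (X *ᵥ θ) lam
    set d := lasso X (response X θ σ w) lam - b₀ with hd
    have hsplit : X i ⬝ᵥ (lasso X (response X θ σ w) lam - θ) = X i ⬝ᵥ d + X i ⬝ᵥ (b₀ - θ) := by
      rw [← dotProduct_add, hd, sub_add_sub_cancel]
    -- With this `r`, `a ^ 2 - 2 * a * r` is the difference of the two squared fits.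
    have := abs_sq_sub_two_mul_le (a := X i ⬝ᵥ d) (r := -(X i ⬝ᵥ (b₀ - θ))) (w := w i) hN
      (h.shiftConst_nonneg hC σ) (h.residualConst_nonneg hC σ) hγ
      (h.abs_row_shift_le hC hγ ?_ i) ?_
    · rw [hsplit]
      convert this using 2
      ring
    · have p1 : 0 ≤ (|σ| * |w i| * C_X + 4 * C_X ^ 2 * C_θ) / n := by
        have := h.nonneg
        positivity
      have := mul_nonneg h.pos.le (l2_nonneg d)
      linarith
    · rw [abs_neg]
      linarith [abs_nonneg (σ * w i)]
  · rw [← errorBound_eq_mean hn]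
    refine mul_le_mul_of_nonneg_right ?_ (errorBound_nonneg _ _ _)
    rw [errorConst]
    linarith

theorem abs_cvRisk_sub_noiselessLoss_le (h : GoodDesign X c C_X) (hθ : ∑ j, |θ j| ≤ C_θ) (σ : ℝ)
    (w : Fin n → ℝ) {lam : ℝ} (hlam : 0 ≤ lam) :
    |cvRisk X (response X θ σ w) lam -
      (noiselessLoss X θ lam + σ ^ 2 * (1 / (n : ℝ) * ∑ i, w i ^ 2))| ≤
      errorConst c C_X C_θ σ * errorBound X σ w := by
  have hn := h.card_pos
  have hC : 0 ≤ C_θ := (Finset.sum_nonneg fun j _ => abs_nonneg _).trans hθ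
  have hN : (1 : ℝ) ≤ n := by exact_mod_cast (by have := h.two_le; omega : 1 ≤ n)
  have hγ := l2_nonneg (score X (σ • w))
  have hres := fun i => h.abs_residual_le hθ σ (w i) i hlam
  have hloo := fun i => h.l2_lassoLOO_sub_le hθ σ w i hlam
  have hb := h.l2_lasso_noiseless_sub_le hθ hlam
  rw [cvRisk, noiselessLoss_eq]
  set b₀ := lasso X (X *ᵥ θ) lam
  set d := fun i => lassoLOO X (response X θ σ w) i lam - b₀ with hd
  set e := b₀ - θ with he
  -- The cross term of noise and noiseless error is of order one for each `i`. It is kept apart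
  -- because its mean is a score, which is small.
  have hrow : ∀ i, (response X θ σ w i - X i ⬝ᵥ lassoLOO X (response X θ σ w) i lam) ^ 2 =
      (X i ⬝ᵥ e) ^ 2 + σ ^ 2 * w i ^ 2 - 2 * ((σ • w) i * (X *ᵥ e) i) +
      ((X i ⬝ᵥ d i) ^ 2 - 2 * (X i ⬝ᵥ d i) * (σ * w i - X i ⬝ᵥ e)) := by
    intro i
    have e1 : X i ⬝ᵥ lassoLOO X (response X θ σ w) i lam = X i ⬝ᵥ d i + X i ⬝ᵥ e + X i ⬝ᵥ θ := by
      rw [← dotProduct_add, ← dotProduct_add]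
      congr 1
      simp only [hd, he]
      abel
    have e2 : response X θ σ w i = X i ⬝ᵥ θ + σ * w i := rfl
    have e3 : (X *ᵥ e) i = X i ⬝ᵥ e := rfl
    rw [e1, e2, e3, Pi.smul_apply, smul_eq_mul]
    ring
  have hsum : 1 / (n : ℝ) * ∑ i, (response X θ σ w i -
        X i ⬝ᵥ lassoLOO X (response X θ σ w) i lam) ^ 2 -
      (1 / (n : ℝ) * ∑ i, (X i ⬝ᵥ e) ^ 2 + σ ^ 2 * (1 / (n : ℝ) * ∑ i, w i ^ 2)) =
      1 / (n : ℝ) * ∑ i, ((X i ⬝ᵥ d i) ^ 2 - 2 * (X i ⬝ᵥ d i) * (σ * w i - X i ⬝ᵥ e)) -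
      2 * (score X (σ • w) ⬝ᵥ e) := by
    rw [score_dotProduct, Finset.sum_congr rfl fun i _ => hrow i, Finset.sum_add_distrib,
      Finset.sum_sub_distrib, Finset.sum_add_distrib, ← Finset.mul_sum, ← Finset.mul_sum]
    simp only [dotProduct]
    ring
  rw [hsum]
  have hmain := mean_mul_le_of_le (K := 4 * shiftConst c C_X C_θ σ ^ 2 +
    6 * shiftConst c C_X C_θ σ * residualConst C_X C_θ σ)
    (f := fun i => (X i ⬝ᵥ d i) ^ 2 - 2 * (X i ⬝ᵥ d i) * (σ * w i - X i ⬝ᵥ e))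
    (g := fun i => √n * l2 (score X (σ • w)) ^ 2 + (1 + w i ^ 2) / √n) fun i =>
      abs_sq_sub_two_mul_le hN (h.shiftConst_nonneg hC σ) (h.residualConst_nonneg hC σ) hγ
        (h.abs_row_shift_le hC hγ (hloo i) i) ((abs_sub _ _).trans (hres i))
  rw [← errorBound_eq_mean hn] at hmain
  -- Entering twice, this accounts for the summand `4 * C_θ` of `errorConst`.
  have hcross : |score X (σ • w) ⬝ᵥ e| ≤ 2 * C_θ * errorBound X σ w := by
    refine (abs_dotProduct_le_l2_mul_l2 _ _).trans ?_
    rw [mul_comm (2 * C_θ)]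
    exact mul_le_mul (l2_score_le_errorBound hn X σ w) hb (l2_nonneg _) (errorBound_nonneg _ _ _)
  refine (abs_sub _ _).trans ?_
  rw [abs_mul 2, abs_two, errorConst]
  linarith

end GoodDesign

end LassoCV

namespace LassoCV

/-! ### Moments of sub-Gaussian noise and the mean of the error bound. -/

section Moments

variable {Ω : Type*} [MeasurableSpace Ω] {μ : Measure Ω} [IsProbabilityMeasure μ]

/-- A sub-Gaussian random variable, with the centered bound on its moment-generating function, has
mean zero. -/
theorem integral_eq_zero_of_hasSubgaussianMGF {W : Ω → ℝ} {v : ℝ≥0} (h : HasSubgaussianMGF W v μ) :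
    ∫ ω, W ω ∂μ = 0 := by
  have h0 : (0 : ℝ) ∈ interior (integrableExpSet W μ) := by
    rw [h.integrableExpSet_eq_univ]; simp
  have hd := (hasDerivAt_mgf h0)
  simp only [zero_mul, Real.exp_zero, mul_one] at hd
  have he : HasDerivAt (fun t : ℝ => Real.exp (v * t ^ 2 / 2)) 0 0 := by
    have : HasDerivAt (fun t : ℝ => (v : ℝ) * t ^ 2 / 2) 0 0 := by
      simpa using ((hasDerivAt_pow 2 (0 : ℝ)).const_mul (v : ℝ)).div_const 2
    simpa using this.exp
  -- The moment-generating function touches its Gaussian bound at `0`, so the derivatives agree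
  -- there.
  have hmin : IsLocalMin (fun t : ℝ => Real.exp (v * t ^ 2 / 2) - mgf W μ t) 0 := by
    refine Eventually.of_forall fun t => ?_
    have := h.mgf_le t
    simpa [mgf_zero] using this
  have := hmin.hasDerivAt_eq_zero (he.sub hd)
  linarith

theorem pow_le_factorial_mul_exp_add_exp {k : ℕ} (hk : Even k) (x : ℝ) :
    x ^ k ≤ k.factorial * (Real.exp x + Real.exp (-x)) := by
  have h1 := Real.pow_div_factorial_le_exp |x| (abs_nonneg x) k
  rw [hk.pow_abs, div_le_iff₀ (by positivity)] at h1
  have h2 : Real.exp |x| ≤ Real.exp x + Real.exp (-x) := by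
    rcases abs_choice x with h | h <;> rw [h] <;> linarith [Real.exp_pos x, Real.exp_pos (-x)]
  have h3 : (0 : ℝ) ≤ k.factorial := by positivity
  nlinarith

theorem integrable_pow_of_hasSubgaussianMGF {W : Ω → ℝ} {v : ℝ≥0} (h : HasSubgaussianMGF W v μ)
    (k : ℕ) : Integrable (fun ω => W ω ^ k) μ := by
  rcases Nat.eq_zero_or_pos k with rfl | hk
  · simp
  · have := (h.memLp k).integrable_norm_pow hk.ne'
    refine this.mono (h.aestronglyMeasurable.pow k) (Eventually.of_forall fun ω => ?_)
    simp

/-- Even moments of a sub-Gaussian random variable. -/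
theorem integral_pow_le_of_hasSubgaussianMGF {W : Ω → ℝ} {v : ℝ≥0} (h : HasSubgaussianMGF W v μ)
    {k : ℕ} (hk : Even k) :
    ∫ ω, W ω ^ k ∂μ ≤ k.factorial * (2 * Real.exp (v / 2)) := by
  have i1 : Integrable (fun ω => Real.exp (W ω)) μ := by simpa using h.integrable_exp_mul 1
  have i2 : Integrable (fun ω => Real.exp (-W ω)) μ := by simpa using h.integrable_exp_mul (-1)
  have m1 : ∫ ω, Real.exp (W ω) ∂μ ≤ Real.exp (v / 2) := by simpa [mgf] using h.mgf_le 1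
  have m2 : ∫ ω, Real.exp (-W ω) ∂μ ≤ Real.exp (v / 2) := by simpa [mgf] using h.mgf_le (-1)
  calc ∫ ω, W ω ^ k ∂μ ≤ ∫ ω, k.factorial * (Real.exp (W ω) + Real.exp (-W ω)) ∂μ :=
        integral_mono (integrable_pow_of_hasSubgaussianMGF h k) ((i1.add i2).const_mul _)
          fun ω => pow_le_factorial_mul_exp_add_exp hk _
    _ = k.factorial * (∫ ω, Real.exp (W ω) ∂μ + ∫ ω, Real.exp (-W ω) ∂μ) := by
        rw [integral_const_mul, integral_add i1 i2]
    _ ≤ _ := mul_le_mul_of_nonneg_left (by linarith) (by positivity)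

/-- A bound on the second and fourth moments of the noise. -/
noncomputable def momentBound (v : ℝ≥0) : ℝ := 24 * (2 * Real.exp (v / 2))

theorem momentBound_pos (v : ℝ≥0) : 0 < momentBound v := by unfold momentBound; positivity

theorem integral_sq_le_momentBound {W : Ω → ℝ} {v : ℝ≥0} (h : HasSubgaussianMGF W v μ) :
    ∫ ω, W ω ^ 2 ∂μ ≤ momentBound v := by
  refine (integral_pow_le_of_hasSubgaussianMGF h even_two).trans ?_
  rw [momentBound]
  exact mul_le_mul_of_nonneg_right (by norm_num [Nat.factorial]) (by positivity)

theorem integral_pow_four_le_momentBound {W : Ω → ℝ} {v : ℝ≥0} (h : HasSubgaussianMGF W v μ) :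
    ∫ ω, W ω ^ 4 ∂μ ≤ momentBound v := by
  refine (integral_pow_le_of_hasSubgaussianMGF h (by decide : Even 4)).trans ?_
  rw [momentBound]
  exact mul_le_mul_of_nonneg_right (by norm_num [Nat.factorial]) (by positivity)

variable {n p : ℕ} {W : Fin n → Ω → ℝ} {v : ℝ≥0}

/-- Independent centered variables are orthogonal in `L²`. This is applied to the coordinates of the
score. -/
theorem integral_sq_sum_mul_le (hW : ∀ i, HasSubgaussianMGF (W i) v μ) (hind : iIndepFun W μ)
    (a : Fin n → ℝ) :
    Integrable (fun ω => (∑ i, a i * W i ω) ^ 2) μ ∧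
      ∫ ω, (∑ i, a i * W i ω) ^ 2 ∂μ ≤ momentBound v * ∑ i, a i ^ 2 := by
  have hL : ∀ i, MemLp (fun ω => a i * W i ω) 2 μ := fun i =>
    ((hW i).memLp 2).const_mul (a i)
  have hsum : MemLp (∑ i, fun ω => a i * W i ω) 2 μ := memLp_finsetSum' _ fun i _ => hL i
  have hmean : ∫ ω, (∑ i, fun ω => a i * W i ω) ω ∂μ = 0 := by
    simp only [Finset.sum_apply]
    rw [integral_finsetSum _ fun i _ => (hL i).integrable one_le_two]
    refine Finset.sum_eq_zero fun i _ => ?_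
    rw [integral_const_mul, integral_eq_zero_of_hasSubgaussianMGF (hW i), mul_zero]
  have hvar := variance_of_integral_eq_zero hsum.aestronglyMeasurable.aemeasurable hmean
  rw [IndepFun.variance_sum (fun i _ => hL i)] at hvar
  · simp only [Finset.sum_apply] at hvar
    refine ⟨by simpa using hsum.integrable_sq, ?_⟩
    rw [← hvar, Finset.mul_sum]
    refine Finset.sum_le_sum fun i _ => ?_
    rw [variance_const_mul, variance_of_integral_eq_zero (hW i).aemeasurable
      (integral_eq_zero_of_hasSubgaussianMGF (hW i)), mul_comm]
    exact mul_le_mul_of_nonneg_right (integral_sq_le_momentBound (hW i)) (sq_nonneg _)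
  · intro i _ j _ hij
    have := (hind.indepFun hij).comp (φ := fun x => a i * x) (ψ := fun x => a j * x)
      (by fun_prop) (by fun_prop)
    exact this

/-- The mean of the squared noise concentrates if the noise has unit variance. -/
theorem integral_abs_mean_sq_sub_one_le (hn : 0 < n) (hW : ∀ i, HasSubgaussianMGF (W i) v μ)
    (hind : iIndepFun W μ) (hvar : ∀ i, Var[W i; μ] = 1) :
    Integrable (fun ω => |1 / (n : ℝ) * ∑ i, W i ω ^ 2 - 1|) μ ∧
      ∫ ω, |1 / (n : ℝ) * ∑ i, W i ω ^ 2 - 1| ∂μ ≤ (momentBound v + 1) / √n := by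
  have hn' : (0 : ℝ) < n := by exact_mod_cast hn
  have hs := Real.sqrt_pos.2 hn'
  have hss : √(n : ℝ) ^ 2 = n := Real.sq_sqrt hn'.le
  have hL : ∀ i, MemLp (fun ω => 1 / (n : ℝ) * W i ω ^ 2) 2 μ := by
    intro i
    refine MemLp.const_mul ?_ _
    refine (memLp_two_iff_integrable_sq ((hW i).aestronglyMeasurable.pow 2)).2 ?_
    simpa [← pow_mul] using integrable_pow_of_hasSubgaussianMGF (hW i) 4
  have hsq : ∀ i, ∫ ω, W i ω ^ 2 ∂μ = 1 := fun i => by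
    rw [← hvar i, variance_of_integral_eq_zero (hW i).aemeasurable
      (integral_eq_zero_of_hasSubgaussianMGF (hW i))]
  have hsum : MemLp (∑ i, fun ω => 1 / (n : ℝ) * W i ω ^ 2) 2 μ :=
    memLp_finsetSum' _ fun i _ => hL i
  have hmean : ∫ ω, (∑ i, fun ω => 1 / (n : ℝ) * W i ω ^ 2) ω ∂μ = 1 := by
    simp only [Finset.sum_apply]
    rw [integral_finsetSum _ fun i _ => (hL i).integrable one_le_two]
    simp_rw [integral_const_mul, hsq]
    simp [hn'.ne']
  have hv := variance_eq_integral (μ := μ) hsum.aestronglyMeasurable.aemeasurable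
  rw [hmean, IndepFun.variance_sum (fun i _ => hL i)] at hv
  · have e : ∀ ω, (∑ i, fun ω => 1 / (n : ℝ) * W i ω ^ 2) ω = 1 / (n : ℝ) * ∑ i, W i ω ^ 2 := by
      intro ω; rw [Finset.sum_apply, Finset.mul_sum]
    have hd : MemLp (fun ω => 1 / (n : ℝ) * ∑ i, W i ω ^ 2 - 1) 2 μ := by
      have := hsum.sub (memLp_const (1 : ℝ))
      refine this.ae_eq (Eventually.of_forall fun ω => ?_)
      simp only [Pi.sub_apply, e]
    simp_rw [e] at hv
    have hle : ∫ ω, (1 / (n : ℝ) * ∑ i, W i ω ^ 2 - 1) ^ 2 ∂μ ≤ momentBound v / n := by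
      rw [← hv]
      have : ∀ i ∈ Finset.univ, Var[fun ω => 1 / (n : ℝ) * W i ω ^ 2; μ] ≤
          (1 / (n : ℝ)) ^ 2 * momentBound v := by
        intro i _
        rw [variance_const_mul]
        refine mul_le_mul_of_nonneg_left ?_ (sq_nonneg _)
        refine (variance_le_expectation_sq ((hW i).aestronglyMeasurable.pow 2)).trans ?_
        simpa [← pow_mul] using integral_pow_four_le_momentBound (hW i)
      refine (Finset.sum_le_sum this).trans (le_of_eq ?_)
      simp only [Finset.sum_const, Finset.card_univ, Fintype.card_fin, nsmul_eq_mul]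
      field_simp
    have habs : Integrable (fun ω => |1 / (n : ℝ) * ∑ i, W i ω ^ 2 - 1|) μ :=
      (hd.integrable one_le_two).abs
    refine ⟨habs, ?_⟩
    -- The weight `√n` matches a second moment of order `1 / n`.
    have hpt : ∀ x : ℝ, |x| ≤ √n * x ^ 2 + 1 / √n := by
      intro x
      have : √n * x ^ 2 + 1 / √n - |x| = ((√n * |x| - 1 / 2) ^ 2 + 3 / 4) / √n := by
        rw [← sq_abs x]
        field_simp
        ring
      have : 0 ≤ ((√n * |x| - 1 / 2) ^ 2 + 3 / 4) / √n := by positivity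
      linarith
    calc ∫ ω, |1 / (n : ℝ) * ∑ i, W i ω ^ 2 - 1| ∂μ
        ≤ ∫ ω, (√n * (1 / (n : ℝ) * ∑ i, W i ω ^ 2 - 1) ^ 2 + 1 / √n) ∂μ :=
          integral_mono habs ((hd.integrable_sq.const_mul _).add (integrable_const _))
            fun ω => hpt _
      _ = √n * ∫ ω, (1 / (n : ℝ) * ∑ i, W i ω ^ 2 - 1) ^ 2 ∂μ + 1 / √n := by
          rw [integral_add (hd.integrable_sq.const_mul _) (integrable_const _),
            integral_const_mul]
          simp
      _ ≤ √n * (momentBound v / n) + 1 / √n := by gcongr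
      _ = (momentBound v + 1) / √n := by
          have : √n * (momentBound v / n) = momentBound v / √n := by
            rw [← hss]; field_simp; simp
          rw [this]; ring
  · intro i _ j _ hij
    have := (hind.indepFun hij).comp (φ := fun x => 1 / (n : ℝ) * x ^ 2)
      (ψ := fun x => 1 / (n : ℝ) * x ^ 2) (by fun_prop) (by fun_prop)
    exact this

theorem integral_errorBound_le (hn : 0 < n) (hW : ∀ i, HasSubgaussianMGF (W i) v μ)
    (hind : iIndepFun W μ) {X : Matrix (Fin n) (Fin p) ℝ} {C_X : ℝ}
    (hX : ∀ i, l2 (X i) ≤ C_X) (σ : ℝ) :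
    Integrable (fun ω => errorBound X σ fun i => W i ω) μ ∧
      ∫ ω, errorBound X σ (fun i => W i ω) ∂μ ≤
        (momentBound v * σ ^ 2 * C_X ^ 2 + 1 + momentBound v) / √n := by
  have hn' : (0 : ℝ) < n := by exact_mod_cast hn
  have hs := Real.sqrt_pos.2 hn'
  have hss : √(n : ℝ) ^ 2 = n := Real.sq_sqrt hn'.le
  have hm := momentBound_pos v
  have hscore : ∀ ω, l2 (score X (σ • fun i => W i ω)) ^ 2 =
      ∑ j, (∑ i, (1 / (n : ℝ) * σ * X i j) * W i ω) ^ 2 := by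
    intro ω
    rw [l2_sq_eq_sum]
    refine Finset.sum_congr rfl fun j _ => ?_
    congr 1
    simp only [score, Pi.smul_apply, Matrix.mulVec, dotProduct, Matrix.transpose_apply,
      smul_eq_mul, Finset.mul_sum]
    exact Finset.sum_congr rfl fun i _ => by ring
  have hcoord := fun j => integral_sq_sum_mul_le hW hind fun i => 1 / (n : ℝ) * σ * X i j
  have i1 : Integrable (fun ω => l2 (score X (σ • fun i => W i ω)) ^ 2) μ := by
    simp_rw [hscore]
    exact integrable_finsetSum _ fun j _ => (hcoord j).1
  have m1 : ∫ ω, l2 (score X (σ • fun i => W i ω)) ^ 2 ∂μ ≤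
      momentBound v * σ ^ 2 * C_X ^ 2 / n := by
    simp_rw [hscore]
    rw [integral_finsetSum _ fun j _ => (hcoord j).1]
    calc ∑ j, ∫ ω, (∑ i, (1 / (n : ℝ) * σ * X i j) * W i ω) ^ 2 ∂μ
        ≤ ∑ j, momentBound v * ∑ i, (1 / (n : ℝ) * σ * X i j) ^ 2 :=
          Finset.sum_le_sum fun j _ => (hcoord j).2
      -- Exchanging the sums over coordinates and observations makes the row norms appear, so the
      -- bound does not depend on `p`.
      _ = momentBound v * (1 / (n : ℝ) * σ) ^ 2 * ∑ i, l2 (X i) ^ 2 := by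
          rw [← Finset.mul_sum, Finset.sum_comm, mul_assoc]
          congr 1
          rw [Finset.mul_sum]
          refine Finset.sum_congr rfl fun i _ => ?_
          rw [l2_sq_eq_sum, Finset.mul_sum]
          exact Finset.sum_congr rfl fun j _ => by rw [mul_pow]
      _ ≤ momentBound v * (1 / (n : ℝ) * σ) ^ 2 * (n * C_X ^ 2) := by
          refine mul_le_mul_of_nonneg_left ?_ (by positivity)
          refine (Finset.sum_le_sum (g := fun _ => C_X ^ 2) fun i _ =>
            pow_le_pow_left₀ (l2_nonneg _) (hX i) 2).trans ?_
          simp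
      _ = momentBound v * σ ^ 2 * C_X ^ 2 / n := by field_simp
  have i2 : Integrable (fun ω => ∑ i, W i ω ^ 2) μ :=
    integrable_finsetSum _ fun i _ => integrable_pow_of_hasSubgaussianMGF (hW i) 2
  have m2 : ∫ ω, ∑ i, W i ω ^ 2 ∂μ ≤ n * momentBound v := by
    rw [integral_finsetSum _ fun i _ => integrable_pow_of_hasSubgaussianMGF (hW i) 2]
    refine (Finset.sum_le_sum fun i _ => integral_sq_le_momentBound (hW i)).trans ?_
    simp
  have i3 : Integrable (fun ω => (1 + 1 / (n : ℝ) * ∑ i, W i ω ^ 2) / √n) μ :=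
    ((integrable_const _).add (i2.const_mul _)).div_const _
  refine ⟨(i1.const_mul _).add i3, ?_⟩
  simp only [errorBound]
  rw [integral_add (i1.const_mul _) i3, integral_const_mul, integral_div,
    integral_add (integrable_const _) (i2.const_mul _), integral_const_mul]
  simp only [integral_const, probReal_univ, smul_eq_mul, one_mul]
  have b1 := mul_le_mul_of_nonneg_left m1 hs.le
  have b2 : (1 + 1 / (n : ℝ) * ∫ ω, ∑ i, W i ω ^ 2 ∂μ) / √n ≤ (1 + momentBound v) / √n := by
    refine div_le_div_of_nonneg_right ?_ hs.le
    have := mul_le_mul_of_nonneg_left m2 (by positivity : 0 ≤ 1 / (n : ℝ))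
    have e : 1 / (n : ℝ) * (n * momentBound v) = momentBound v := by field_simp
    linarith
  have e : √n * (momentBound v * σ ^ 2 * C_X ^ 2 / n) = momentBound v * σ ^ 2 * C_X ^ 2 / √n := by
    rw [← hss]; field_simp; simp
  rw [e] at b1
  calc _ ≤ momentBound v * σ ^ 2 * C_X ^ 2 / √n + (1 + momentBound v) / √n := add_le_add b1 b2
    _ = _ := by ring

end Moments

/-! ### From convergence of the Gram matrices to good designs. -/

section Design

variable {p : ℕ}

theorem _root_.Matrix.PosDef.exists_pos_mul_l2_sq_le {C : Matrix (Fin p) (Fin p) ℝ}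
    (hC : C.PosDef) : ∃ c : ℝ, 0 < c ∧ ∀ v, c * l2 v ^ 2 ≤ v ⬝ᵥ (C *ᵥ v) := by
  have hcont : Continuous fun u : EuclideanSpace ℝ (Fin p) => u.ofLp ⬝ᵥ (C *ᵥ u.ofLp) := by
    fun_prop
  obtain ⟨c, hc, h⟩ : ∃ c : ℝ, 0 < c ∧ ∀ u ∈ Metric.sphere (0 : EuclideanSpace ℝ (Fin p)) 1,
      c ≤ u.ofLp ⬝ᵥ (C *ᵥ u.ofLp) := by
    -- The unit sphere is empty if `p = 0`; otherwise compactness gives a positive minimum of the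
    -- quadratic form.
    rcases (Metric.sphere (0 : EuclideanSpace ℝ (Fin p)) 1).eq_empty_or_nonempty with h | h
    · exact ⟨1, one_pos, by simp [h]⟩
    · obtain ⟨u, hu, hmin⟩ := (isCompact_sphere (0 : EuclideanSpace ℝ (Fin p)) 1).exists_isMinOn h
        hcont.continuousOn
      refine ⟨_, ?_, fun u' hu' => hmin hu'⟩
      have hu0 : u.ofLp ≠ 0 := by
        intro h0
        have : u = 0 := by ext i; simp [h0]
        simp [this] at hu
      simpa using hC.dotProduct_mulVec_pos hu0
  refine ⟨c, hc, fun v => ?_⟩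
  rcases eq_or_ne v 0 with rfl | hv
  · simp [l2]
  have hl : 0 < l2 v := by
    rw [norm_pos_iff]
    intro h0
    exact hv (by simpa using h0)
  have := h ((l2 v)⁻¹ • WithLp.toLp 2 v) (by
    rw [mem_sphere_zero_iff_norm, norm_smul, norm_inv, Real.norm_of_nonneg hl.le]
    exact inv_mul_cancel₀ hl.ne')
  rw [WithLp.ofLp_smul, Matrix.mulVec_smul, smul_dotProduct, dotProduct_smul, smul_eq_mul,
    smul_eq_mul, ← mul_assoc, ← mul_inv, ← pow_two, inv_mul_eq_div, le_div_iff₀ (by positivity)]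
    at this
  exact this

theorem abs_dotProduct_mulVec_le_sum_abs (M : Matrix (Fin p) (Fin p) ℝ) (v : Fin p → ℝ) :
    |v ⬝ᵥ (M *ᵥ v)| ≤ (∑ j, ∑ k, |M j k|) * l2 v ^ 2 := by
  simp only [dotProduct, Matrix.mulVec, Finset.mul_sum, Finset.sum_mul]
  refine (Finset.abs_sum_le_sum_abs _ _).trans (Finset.sum_le_sum fun j _ => ?_)
  refine (Finset.abs_sum_le_sum_abs _ _).trans (Finset.sum_le_sum fun k _ => ?_)
  rw [abs_mul, abs_mul]
  have h := mul_le_mul (abs_apply_le_l2 v j) (abs_apply_le_l2 v k) (abs_nonneg _) (l2_nonneg v)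
  calc |v j| * (|M j k| * |v k|) = |M j k| * (|v j| * |v k|) := by ring
    _ ≤ |M j k| * (l2 v * l2 v) := mul_le_mul_of_nonneg_left h (abs_nonneg _)
    _ = _ := by ring

/-- The entrywise deviation from `C` controls the quadratic form uniformly in `v`; once it is below
half of the lower bound for `C`, the other half remains. -/
theorem eventually_goodDesign {X : (n : ℕ) → Matrix (Fin n) (Fin p) ℝ}
    {C : Matrix (Fin p) (Fin p) ℝ} (hC : C.PosDef)
    (hA : Tendsto (fun n : ℕ => (1 / (n : ℝ)) • ((X n)ᵀ * X n)) atTop (𝓝 C))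
    {C_X : ℝ} (hB : ∀ n i, l2 (X n i) ≤ C_X) :
    ∃ c, ∀ᶠ n in atTop, GoodDesign (X n) c C_X := by
  obtain ⟨c, hc, hlow⟩ := hC.exists_pos_mul_l2_sq_le
  have hdev : Tendsto (fun n : ℕ => ∑ j, ∑ k, |((1 / (n : ℝ)) • ((X n)ᵀ * X n) - C) j k|) atTop
      (𝓝 0) := by
    have h0 : Tendsto (fun n : ℕ => (1 / (n : ℝ)) • ((X n)ᵀ * X n) - C) atTop (𝓝 0) := by
      simpa using hA.sub_const C
    have hcont : Continuous fun M : Matrix (Fin p) (Fin p) ℝ => ∑ j, ∑ k, |M j k| := by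
      refine continuous_finsetSum _ fun j _ => continuous_finsetSum _ fun k _ => ?_
      exact (continuous_id.matrix_elem j k).abs
    have := (hcont.tendsto 0).comp h0
    simpa [Function.comp_def] using this
  refine ⟨c / 2, ?_⟩
  have hlarge : ∀ᶠ n : ℕ in atTop, 2 * C_X ^ 2 ≤ n * (c / 2) :=
    (tendsto_natCast_atTop_atTop.atTop_mul_const (half_pos hc)).eventually_ge_atTop _
  filter_upwards [hdev.eventually_le_const (half_pos hc), hlarge, eventually_ge_atTop 2]
    with n h1 h2 h3
  have hn : (0 : ℝ) < n := by exact_mod_cast (by omega : 0 < n)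
  refine ⟨h3, half_pos hc, fun v => ?_, ?_, hB n, h2⟩
  · have a1 := (neg_abs_le _).trans' (neg_le_neg (abs_dotProduct_mulVec_le_sum_abs
      ((1 / (n : ℝ)) • ((X n)ᵀ * X n) - C) v))
    have a2 := mul_le_mul_of_nonneg_right h1 (sq_nonneg (l2 v))
    have a3 := hlow v
    have a4 : v ⬝ᵥ (((1 / (n : ℝ)) • ((X n)ᵀ * X n) - C) *ᵥ v) =
        1 / (n : ℝ) * l2 (X n *ᵥ v) ^ 2 - v ⬝ᵥ (C *ᵥ v) := by
      rw [Matrix.sub_mulVec, dotProduct_sub, Matrix.smul_mulVec, dotProduct_smul, smul_eq_mul,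
        l2_sq, ← Matrix.mulVec_mulVec, Matrix.dotProduct_mulVec, Matrix.vecMul_transpose]
    rw [a4] at a1
    have a5 : c / 2 * l2 v ^ 2 ≤ 1 / (n : ℝ) * l2 (X n *ᵥ v) ^ 2 := by linarith
    rw [one_div, le_inv_mul_iff₀ hn] at a5
    linarith
  · exact (l2_nonneg _).trans (hB n ⟨0, by omega⟩)

end Design

/-! ### Joint continuity in responses and tuning parameter. -/

section Measurability

variable {n p : ℕ} {X : Matrix (Fin n) (Fin p) ℝ} {c C_X : ℝ}

/-- This makes the loss measurable although the minimizer is chosen by `Classical.epsilon`. The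
Lipschitz bound requires nonnegative parameters, hence the truncation at `0`. -/
theorem GoodDesign.continuous_lasso (h : GoodDesign X c C_X) :
    Continuous fun q : (Fin n → ℝ) × ℝ => lasso X q.1 (max q.2 0) := by
  rw [continuous_iff_continuousAt]
  intro q₀
  rw [ContinuousAt, tendsto_iff_norm_sub_tendsto_zero]
  have hbound : Tendsto (fun q : (Fin n → ℝ) × ℝ =>
      (l2 (score X (q.1 - q₀.1)) + |max q.2 0 - max q₀.2 0| * p) / c) (𝓝 q₀) (𝓝 0) := by
    have hcont : Continuous fun q : (Fin n → ℝ) × ℝ =>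
        (l2 (score X (q.1 - q₀.1)) + |max q.2 0 - max q₀.2 0| * p) / c := by
      have := continuous_score X
      unfold l2
      fun_prop
    have := hcont.tendsto q₀
    simpa [score, l2] using this
  refine squeeze_zero (fun _ => norm_nonneg _) (fun q => ?_) hbound
  have h1 := h.l2_lasso_sub_lasso_le q.1 q₀.1 (le_max_right q.2 0) (le_max_right q₀.2 0)
  rw [le_div_iff₀ h.pos, mul_comm]
  refine le_trans (mul_le_mul_of_nonneg_left ?_ h.pos.le) h1
  exact (pi_norm_le_iff_of_nonneg (l2_nonneg _)).2 fun j => abs_apply_le_l2 _ j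

theorem GoodDesign.continuous_loss (h : GoodDesign X c C_X) (θ : Fin p → ℝ) :
    Continuous fun q : (Fin n → ℝ) × ℝ => loss X θ q.1 (max q.2 0) := by
  simp only [loss_eq]
  have := h.continuous_lasso
  fun_prop

end Measurability

end LassoCV

namespace LassoCV

/-! ### From bounds in mean to convergence in probability. -/

section Limits

theorem tendsto_div_sqrt_natCast (A : ℝ) : Tendsto (fun n : ℕ => A / √(n : ℝ)) atTop (𝓝 0) :=
  (Real.tendsto_sqrt_atTop.comp tendsto_natCast_atTop_atTop).const_div_atTop A

/-- Convergence to zero in mean implies convergence in probability. -/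
theorem tendsto_measure_le_ofReal_of_integral_le {Ω : Type*} [MeasurableSpace Ω]
    {μ : Measure Ω} {f : ℕ → Ω → ℝ} {A : ℝ}
    (hf : ∀ᶠ n : ℕ in atTop, (∀ ω, 0 ≤ f n ω) ∧ Integrable (f n) μ ∧
      ∫ ω, f n ω ∂μ ≤ A / √(n : ℝ)) {ε : ℝ≥0∞} (hε : 0 < ε) :
    Tendsto (fun n => μ {ω | ε ≤ ENNReal.ofReal (f n ω)}) atTop (𝓝 0) := by
  -- Markov's inequality needs a finite level; at `∞` the event is empty.
  rcases eq_or_ne ε ∞ with rfl | hε'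
  · simp
  have hlim : Tendsto (fun n : ℕ => ENNReal.ofReal (A / √(n : ℝ)) / ε) atTop (𝓝 0) := by
    have := ENNReal.Tendsto.div_const (ENNReal.tendsto_ofReal (tendsto_div_sqrt_natCast A))
      (Or.inr hε.ne') (b := ε)
    simpa using this
  refine tendsto_of_tendsto_of_tendsto_of_le_of_le' tendsto_const_nhds hlim
    (Eventually.of_forall fun _ => zero_le) ?_
  filter_upwards [hf] with n ⟨h0, hi, hle⟩
  refine (meas_ge_le_lintegral_div hi.aemeasurable.ennreal_ofReal hε.ne' hε').trans ?_
  rw [← ofReal_integral_eq_lintegral_ofReal hi (Eventually.of_forall h0)]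
  exact ENNReal.div_le_div_right (ENNReal.ofReal_le_ofReal hle) _

end Limits

/-! ### Integrability of the loss and comparison of the risks. -/

section Risk

variable {Ω : Type*} [MeasurableSpace Ω] {μ : Measure Ω} [IsProbabilityMeasure μ]
  {n p : ℕ} {X : Matrix (Fin n) (Fin p) ℝ} {c C_X C_θ : ℝ} {θ : Fin p → ℝ} {W : Fin n → Ω → ℝ}
  {v : ℝ≥0}

/-- The expectation of the error bound, with its constant, up to `1 / √n`. -/
noncomputable def rateConst (c C_X C_θ σ : ℝ) (v : ℝ≥0) : ℝ :=
  errorConst c C_X C_θ σ * (momentBound v * σ ^ 2 * C_X ^ 2 + 1 + momentBound v)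

namespace GoodDesign

/-- Being uniform in `lam`, this supplies an integrable majorant for the loss at a random tuning
parameter. -/
theorem noiselessLoss_le (h : GoodDesign X c C_X) (hθ : ∑ j, |θ j| ≤ C_θ) {lam : ℝ}
    (hlam : 0 ≤ lam) : noiselessLoss X θ lam ≤ C_X ^ 2 * (2 * C_θ) ^ 2 := by
  have h1 := (le_abs_self _).trans <| mean_mul_le_of_le (K := C_X ^ 2 * (2 * C_θ) ^ 2)
    (f := fun i => (X i ⬝ᵥ (lasso X (X *ᵥ θ) lam - θ)) ^ 2) (g := fun _ => 1) fun i => by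
      rw [mul_one, abs_pow, ← mul_pow]
      exact pow_le_pow_left₀ (abs_nonneg _) ((h.abs_row_dotProduct_le i _).trans
        (mul_le_mul_of_nonneg_left (h.l2_lasso_noiseless_sub_le hθ hlam) h.nonneg)) 2
  have hn := h.card_pos
  rw [noiselessLoss_eq]
  refine h1.trans (le_of_eq ?_)
  simp [hn.ne']

theorem integral_errorConst_mul_le (h : GoodDesign X c C_X) (hC : 0 ≤ C_θ) (σ : ℝ)
    (hW : ∀ i, HasSubgaussianMGF (W i) v μ) (hind : iIndepFun W μ) :
    Integrable (fun ω => errorConst c C_X C_θ σ * errorBound X σ fun i => W i ω) μ ∧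
      ∫ ω, errorConst c C_X C_θ σ * errorBound X σ (fun i => W i ω) ∂μ ≤
        rateConst c C_X C_θ σ v / √n := by
  have hn : 0 < n := by exact_mod_cast h.card_pos
  obtain ⟨h1, h2⟩ := integral_errorBound_le hn hW hind h.row_le σ
  refine ⟨h1.const_mul _, ?_⟩
  rw [integral_const_mul, rateConst, mul_div_assoc]
  exact mul_le_mul_of_nonneg_left h2 (h.errorConst_nonneg hC σ)

/-- The loss of the lasso is integrable, also if it is tuned by the data. -/
theorem integrable_loss (h : GoodDesign X c C_X) (hθ : ∑ j, |θ j| ≤ C_θ) (σ : ℝ)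
    (hW : ∀ i, HasSubgaussianMGF (W i) v μ) (hind : iIndepFun W μ) {L : Ω → ℝ}
    (hL : AEMeasurable L μ) (hL0 : ∀ᵐ ω ∂μ, 0 ≤ L ω) :
    Integrable (fun ω => loss X θ (response X θ σ fun i => W i ω) (L ω)) μ := by
  have hC : 0 ≤ C_θ := (Finset.sum_nonneg fun j _ => abs_nonneg _).trans hθ
  have hmeas : AEMeasurable (fun ω => (response X θ σ (fun i => W i ω), L ω)) μ := by
    refine AEMeasurable.prodMk ?_ hL
    refine aemeasurable_pi_lambda _ fun i => ?_
    have : (fun ω => response X θ σ (fun i => W i ω) i) =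
        fun ω => (X *ᵥ θ) i + σ * W i ω := rfl
    rw [this]
    exact ((hW i).aemeasurable.const_mul σ).const_add _
  have hsm : AEStronglyMeasurable
      (fun ω => loss X θ (response X θ σ fun i => W i ω) (L ω)) μ := by
    have h1 := ((h.continuous_loss θ).measurable.comp_aemeasurable hmeas).aestronglyMeasurable
    refine h1.congr ?_
    filter_upwards [hL0] with ω hω
    simp [max_eq_left hω]
  refine Integrable.mono' ((integrable_const (C_X ^ 2 * (2 * C_θ) ^ 2)).add
    (h.integral_errorConst_mul_le hC σ hW hind).1) hsm ?_
  filter_upwards [hL0] with ω hω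
  have h1 := h.abs_loss_sub_noiselessLoss_le hθ σ (fun i => W i ω) hω
  have h2 := h.noiselessLoss_le hθ hω
  have h3 : 0 ≤ loss X θ (response X θ σ fun i => W i ω) (L ω) := by unfold loss; positivity
  rw [Real.norm_of_nonneg h3, Pi.add_apply]
  linarith [le_abs_self (loss X θ (response X θ σ fun i => W i ω) (L ω) -
    noiselessLoss X θ (L ω))]

theorem abs_risk_sub_noiselessLoss_le (h : GoodDesign X c C_X) (hθ : ∑ j, |θ j| ≤ C_θ) (σ : ℝ)
    (hW : ∀ i, HasSubgaussianMGF (W i) v μ) (hind : iIndepFun W μ) {lam : ℝ} (hlam : 0 ≤ lam) :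
    |risk μ X θ σ W lam - (noiselessLoss X θ lam + σ ^ 2)| ≤ rateConst c C_X C_θ σ v / √n := by
  have hC : 0 ≤ C_θ := (Finset.sum_nonneg fun j _ => abs_nonneg _).trans hθ
  have hint := h.integrable_loss hθ σ hW hind (L := fun _ => lam) aemeasurable_const
    (Eventually.of_forall fun _ => hlam)
  obtain ⟨i1, m1⟩ := h.integral_errorConst_mul_le hC σ hW hind
  have e : risk μ X θ σ W lam - (noiselessLoss X θ lam + σ ^ 2) =
      ∫ ω, (loss X θ (response X θ σ fun i => W i ω) lam - noiselessLoss X θ lam) ∂μ := by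
    rw [integral_sub hint (integrable_const _), risk]
    simp
  rw [e]
  refine (abs_integral_le_integral_abs).trans (le_trans ?_ m1)
  exact integral_mono (hint.sub (integrable_const _)).abs i1
    fun ω => h.abs_loss_sub_noiselessLoss_le hθ σ (fun i => W i ω) hlam

/-- The noiseless loss at a minimizer of the cross-validated risk is nearly minimal. -/
theorem noiselessLoss_le_of_isMinOn_cvRisk (h : GoodDesign X c C_X) (hθ : ∑ j, |θ j| ≤ C_θ)
    (σ : ℝ) (w : Fin n → ℝ) {Λ : Set ℝ} (hΛ : Λ ⊆ Set.Ici 0) {l lam : ℝ} (hl : l ∈ Λ)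
    (hmin : IsMinOn (cvRisk X (response X θ σ w)) Λ l) (hlam : lam ∈ Λ) :
    noiselessLoss X θ l ≤
      noiselessLoss X θ lam + 2 * (errorConst c C_X C_θ σ * errorBound X σ w) := by
  -- The mean of the squared noise is common to both estimates and cancels.
  have h1 := abs_le.1 (h.abs_cvRisk_sub_noiselessLoss_le hθ σ w (hΛ hl))
  have h2 := abs_le.1 (h.abs_cvRisk_sub_noiselessLoss_le hθ σ w (hΛ hlam))
  have h3 : cvRisk X (response X θ σ w) l ≤ cvRisk X (response X θ σ w) lam := hmin hlam
  linarith [h1.1, h2.2]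

end GoodDesign

theorem integral_const_add_const_mul {f : Ω → ℝ} (hf : Integrable f μ) (a b : ℝ) :
    ∫ ω, (a + b * f ω) ∂μ = a + b * ∫ ω, f ω ∂μ := by
  rw [integral_add (integrable_const _) (hf.const_mul b), integral_const_mul]
  simp

end Risk

end LassoCV

/-! ### The main theorem. -/

theorem theorem1 {Ω : Type*} [MeasurableSpace Ω] (μ : Measure Ω) [IsProbabilityMeasure μ]
    (p : ℕ) (σ : ℝ)
    (X : (n : ℕ) → Matrix (Fin n) (Fin p) ℝ) (θ : ℕ → Fin p → ℝ)
    (W : (n : ℕ) → Fin n → Ω → ℝ)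
    -- Assumption A
    (C : Matrix (Fin p) (Fin p) ℝ) (hC : C.PosDef)
    (hA : Tendsto (fun n : ℕ => (1 / (n : ℝ)) • ((X n)ᵀ * X n)) atTop (𝓝 C))
    -- Assumption B
    (C_X : ℝ) (hB : ∀ n i, ‖WithLp.toLp 2 (X n i)‖ ≤ C_X)
    -- bounded regression vectors
    (C_θ : ℝ) (hθ : ∀ n, ∑ j, |θ n j| ≤ C_θ)
    -- independent, uniformly sub-Gaussian noise
    (hW_meas : ∀ n i, Measurable (W n i))
    (hW_indep : ∀ n, iIndepFun (W n) μ)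
    (τ : ℝ≥0) (hW_subG : ∀ n i, HasSubgaussianMGF (W n i) (τ ^ 2) μ)
    -- the compact set of candidate tuning parameters
    (Λ : Set ℝ) (hΛ_compact : IsCompact Λ) (hΛ_nonneg : Λ ⊆ Set.Ici 0) :
    -- the main claim
    (∀ (lamHat : ℕ → Ω → ℝ) (lam : ℕ → ℝ), (∀ n, AEMeasurable (lamHat n) μ) →
      -- the cross-validated tuning parameter
      (∀ᶠ n in atTop, ∀ᵐ ω ∂μ, lamHat n ω ∈ Λ ∧
        IsMinOn (LassoCV.cvRisk (X n) (LassoCV.response (X n) (θ n) σ fun i => W n i ω)) Λ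
          (lamHat n ω)) →
      -- the oracle tuning parameter
      (∀ᶠ n in atTop, lam n ∈ Λ ∧
        IsMinOn (LassoCV.risk μ (X n) (θ n) σ (W n)) (Set.Ici 0) (lam n)) →
      -- the risk function, evaluated at the random `lamHat n`: convergence in probability
      TendstoInMeasure μ
        (fun n ω => LassoCV.risk μ (X n) (θ n) σ (W n) (lamHat n ω) -
          LassoCV.risk μ (X n) (θ n) σ (W n) (lam n)) atTop (fun _ => 0) ∧
      -- the risk of the lasso tuned by `lamHat n`, a number: convergence of real numbers
      Tendsto (fun n => LassoCV.tunedRisk μ (X n) (θ n) σ (W n) (lamHat n) -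
          LassoCV.risk μ (X n) (θ n) σ (W n) (lam n)) atTop (𝓝 0) ∧
      -- the expectation that defines the latter risk is finite for large `n`
      (∀ᶠ n in atTop, Integrable (fun ω => LassoCV.loss (X n) (θ n)
        (LassoCV.response (X n) (θ n) σ fun i => W n i ω) (lamHat n ω)) μ)) ∧
    -- the expectations that define the risk function are finite for large `n`
    (∀ᶠ n in atTop, ∀ l : ℝ, 0 ≤ l → Integrable (fun ω =>
      LassoCV.loss (X n) (θ n) (LassoCV.response (X n) (θ n) σ fun i => W n i ω) l) μ) ∧
    -- if the noise has unit variance, uniform convergence of the risk estimate in probability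
    ((∀ n i, Var[W n i; μ] = 1) →
      ∀ ε : ℝ≥0∞, 0 < ε → Tendsto (fun n => μ {ω | ε ≤ ⨆ l ∈ Λ,
        ‖LassoCV.cvRisk (X n) (LassoCV.response (X n) (θ n) σ fun i => W n i ω) l -
          LassoCV.risk μ (X n) (θ n) σ (W n) l‖ₑ}) atTop (𝓝 0)) := by
  obtain ⟨c, hgood⟩ := LassoCV.eventually_goodDesign hC hA hB
  have hCθ : 0 ≤ C_θ := (Finset.sum_nonneg fun j _ => abs_nonneg _).trans (hθ 0)
  set K := LassoCV.errorConst c C_X C_θ σ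
  set T : (n : ℕ) → Ω → ℝ := fun n ω => K * LassoCV.errorBound (X n) σ fun i => W n i ω with hT
  set r : ℕ → ℝ := fun n => LassoCV.rateConst c C_X C_θ σ (τ ^ 2) / √(n : ℝ) with hr
  have hbasic : ∀ᶠ n in atTop, (∀ ω, 0 ≤ T n ω) ∧ Integrable (T n) μ ∧ ∫ ω, T n ω ∂μ ≤ r n := by
    filter_upwards [hgood] with n hn
    exact ⟨fun ω => mul_nonneg (hn.errorConst_nonneg hCθ σ) (LassoCV.errorBound_nonneg _ _ _),
      hn.integral_errorConst_mul_le hCθ σ (hW_subG n) (hW_indep n)⟩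
  refine ⟨fun lamHat lam hmeas hcv horacle => ?_, ?_, fun hvar ε hε => ?_⟩
  · have hpointwise : ∀ᶠ n in atTop, ∀ᵐ ω ∂μ,
        |LassoCV.risk μ (X n) (θ n) σ (W n) (lamHat n ω) -
          LassoCV.risk μ (X n) (θ n) σ (W n) (lam n)| ≤ 2 * r n + 2 * T n ω ∧
        |LassoCV.loss (X n) (θ n) (LassoCV.response (X n) (θ n) σ fun i => W n i ω)
          (lamHat n ω) + σ ^ 2 - LassoCV.risk μ (X n) (θ n) σ (W n) (lam n)| ≤
          r n + 3 * T n ω := by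
      -- Optimality of `lam n` gives the lower bounds, also at the random point. For the upper
      -- bounds, the passage between noiseless losses costs `2 * T n ω`, each passage to or from a
      -- risk costs `r n`, and that from the loss costs `T n ω`.
      filter_upwards [hgood, hcv, horacle, hbasic] with n hn hcvn ⟨hlam, hopt⟩ ⟨hT0, hTi, hTr⟩
      have hr0 : 0 ≤ r n := (integral_nonneg hT0).trans hTr
      filter_upwards [hcvn] with ω ⟨hmem, hmin⟩
      have h1 := hn.noiselessLoss_le_of_isMinOn_cvRisk (hθ n) σ (fun i => W n i ω) hΛ_nonneg hmem
        hmin hlam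
      have h2 := abs_le.1 (hn.abs_risk_sub_noiselessLoss_le (hθ n) σ (hW_subG n) (hW_indep n)
        (hΛ_nonneg hmem))
      have h3 := abs_le.1 (hn.abs_risk_sub_noiselessLoss_le (hθ n) σ (hW_subG n) (hW_indep n)
        (hΛ_nonneg hlam))
      have h4 := abs_le.1 (hn.abs_loss_sub_noiselessLoss_le (hθ n) σ (fun i => W n i ω)
        (hΛ_nonneg hmem))
      have h5 : LassoCV.risk μ (X n) (θ n) σ (W n) (lam n) ≤
        LassoCV.risk μ (X n) (θ n) σ (W n) (lamHat n ω) := hopt (hΛ_nonneg hmem)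
      have h6 := hT0 ω
      simp only [hT, hr] at h6 hr0 ⊢
      constructor <;> rw [abs_le] <;> constructor <;> linarith [h2.1, h2.2, h3.1, h3.2, h4.1, h4.2]
    have hint : ∀ᶠ n in atTop, Integrable (fun ω => LassoCV.loss (X n) (θ n)
        (LassoCV.response (X n) (θ n) σ fun i => W n i ω) (lamHat n ω)) μ := by
      filter_upwards [hgood, hcv] with n hn hcvn
      exact hn.integrable_loss (hθ n) σ (hW_subG n) (hW_indep n) (hmeas n)
        (hcvn.mono fun ω hω => hΛ_nonneg hω.1)
    refine ⟨fun ε hε => ?_, ?_, hint⟩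
    · have hlim := LassoCV.tendsto_measure_le_ofReal_of_integral_le (μ := μ)
        (f := fun n ω => 2 * r n + 2 * T n ω) (A := 4 * LassoCV.rateConst c C_X C_θ σ (τ ^ 2))
        (by
          filter_upwards [hbasic] with n ⟨hT0, hTi, hTr⟩
          have hr0 : 0 ≤ r n := (integral_nonneg hT0).trans hTr
          refine ⟨fun ω => by linarith [hT0 ω], (integrable_const _).add (hTi.const_mul 2), ?_⟩
          rw [LassoCV.integral_const_add_const_mul hTi, mul_div_assoc]
          change _ ≤ 4 * r n
          linarith) hε
      refine tendsto_of_tendsto_of_tendsto_of_le_of_le' tendsto_const_nhds hlim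
        (Eventually.of_forall fun _ => zero_le) ?_
      filter_upwards [hpointwise] with n hn
      refine measure_mono_ae ?_
      filter_upwards [hn] with ω hω hmem
      refine le_trans (show ε ≤ _ from hmem) ?_
      rw [edist_zero_right, Real.enorm_eq_ofReal_abs]
      exact ENNReal.ofReal_le_ofReal hω.1
    · refine squeeze_zero_norm' (a := fun n : ℕ =>
        4 * LassoCV.rateConst c C_X C_θ σ (τ ^ 2) / √(n : ℝ)) ?_
        (LassoCV.tendsto_div_sqrt_natCast _)
      filter_upwards [hpointwise, hint, hbasic] with n hn hi ⟨hT0, hTi, hTr⟩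
      have e : LassoCV.tunedRisk μ (X n) (θ n) σ (W n) (lamHat n) -
          LassoCV.risk μ (X n) (θ n) σ (W n) (lam n) =
          ∫ ω, (LassoCV.loss (X n) (θ n) (LassoCV.response (X n) (θ n) σ fun i => W n i ω)
            (lamHat n ω) + σ ^ 2 - LassoCV.risk μ (X n) (θ n) σ (W n) (lam n)) ∂μ := by
        simp_rw [add_sub_assoc]
        rw [integral_add hi (integrable_const _), LassoCV.tunedRisk, integral_const]
        simp [add_sub_assoc]
      rw [e, Real.norm_eq_abs]
      refine abs_integral_le_integral_abs.trans ?_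
      refine (integral_mono_ae ((hi.add (integrable_const _)).sub (integrable_const _)).abs
        ((integrable_const (r n)).add (hTi.const_mul 3)) (hn.mono fun ω hω => hω.2)).trans ?_
      refine (LassoCV.integral_const_add_const_mul hTi (r n) 3).trans_le ?_
      rw [mul_div_assoc]
      change _ ≤ 4 * r n
      linarith
  · filter_upwards [hgood] with n hn l hl
    exact hn.integrable_loss (hθ n) σ (hW_subG n) (hW_indep n) (L := fun _ => l)
      aemeasurable_const (Eventually.of_forall fun _ => hl)
  · have hlim := LassoCV.tendsto_measure_le_ofReal_of_integral_le (μ := μ)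
      (f := fun n ω => r n + T n ω + σ ^ 2 * |1 / (n : ℝ) * ∑ i, W n i ω ^ 2 - 1|)
      (A := 2 * LassoCV.rateConst c C_X C_θ σ (τ ^ 2) +
        σ ^ 2 * (LassoCV.momentBound (τ ^ 2) + 1))
      (by
        filter_upwards [hbasic, eventually_gt_atTop 0] with n ⟨hT0, hTi, hTr⟩ hn
        have hr0 : 0 ≤ r n := (integral_nonneg hT0).trans hTr
        obtain ⟨hSi, hSm⟩ := LassoCV.integral_abs_mean_sq_sub_one_le hn (hW_subG n) (hW_indep n)
          (hvar n)
        refine ⟨fun ω => ?_, ((integrable_const _).add hTi).add (hSi.const_mul _), ?_⟩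
        · have := hT0 ω
          positivity
        have hTc := LassoCV.integral_const_add_const_mul hTi (r n) 1
        simp only [one_mul] at hTc
        have hsplit := integral_add ((integrable_const (r n)).add hTi) (hSi.const_mul (σ ^ 2))
        simp only [Pi.add_apply] at hsplit
        rw [hsplit, hTc, integral_const_mul (σ ^ 2), add_div, mul_div_assoc, mul_div_assoc]
        change _ ≤ 2 * r n + _
        have := mul_le_mul_of_nonneg_left hSm (sq_nonneg σ)
        linarith) hε
    refine tendsto_of_tendsto_of_tendsto_of_le_of_le' tendsto_const_nhds hlim
      (Eventually.of_forall fun _ => zero_le) ?_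
    filter_upwards [hgood] with n hn
    -- Monotonicity of the measure needs no measurability of the event, which involves a possibly
    -- uncountable supremum. The bound on each term is free of `l`.
    refine measure_mono fun ω hω => ?_
    refine le_trans (show ε ≤ _ from hω) (iSup₂_le fun l hl => ?_)
    rw [Real.enorm_eq_ofReal_abs]
    refine ENNReal.ofReal_le_ofReal ?_
    have h1 := abs_le.1 (hn.abs_cvRisk_sub_noiselessLoss_le (hθ n) σ (fun i => W n i ω)
      (hΛ_nonneg hl))
    have h2 := abs_le.1 (hn.abs_risk_sub_noiselessLoss_le (hθ n) σ (hW_subG n) (hW_indep n)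
      (hΛ_nonneg hl))
    have h3 : |σ ^ 2 * (1 / (n : ℝ) * ∑ i, W n i ω ^ 2 - 1)| =
        σ ^ 2 * |1 / (n : ℝ) * ∑ i, W n i ω ^ 2 - 1| := by
      rw [abs_mul, abs_of_nonneg (sq_nonneg σ)]
    have h4 := abs_le.1 h3.le
    simp only [hT, hr]
    rw [abs_le]
    constructor <;> linarith [h1.1, h1.2, h2.1, h2.2, h4.1, h4.2]
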